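/- Let $\mathcal P$ be the unital $*$-algebra of complex polynomials in $n$ non-commuting Hermitian variables $x_1,\dots,x_n$, and $\mathcal P_d$ the space of those of degree at most $d$. Let $f$, $g_1,\dots,g_m$, $h_1,\dots,h_{m'}\in\mathcal P$ be Hermitian, and consider the NPO problem of minimizing $\sigma(f)$ over all linear functionals $\sigma:\mathcal P\to\mathbb C$ with $\sigma(1)=1$ and, for all $p,q\in\mathcal P$ and all $i,j$, $\sigma(pp^*)\ge 0$, $\sigma(pg_ip^*)\ge0$, $\sigma(ph_jq)=0$. A minimizer $\sigma^\star$ is called *bounded* if its GNS construction yields bounded operators, i.e. for each $i$ the map $[p]\mapsto[x_ip]$ is bounded for the seminorm $\sigma^\star(p^*p)^{1/2}$. The problem is *Archimedean* if for some real $K>0$ the polynomial $K-\sum_i x_i^2$ is a finite sum of terms of the form $s^*s$, $s^*g_is$ and $s^+h_j(s^-)^*+s^-h_j(s^+)^*$ with $s,s^\pm\in\mathcal P$. For $p\in\mathcal P$ and $t\in\mathcal P^{n}$, let $\nabla p(t)$ be the part of $p(x+\epsilon t)$ that is linear in $\epsilon$. If $\nabla p(t)=\sum_{a,l}s_{al}^+t_l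 s_{al}^-$ is the expansion obtained by replacing in turn each letter of each word of $p$ by the corresponding entry of $t$, put $\deg(\nabla p)=\max_{a,l}(\deg s_{al}^++\deg s_{al}^-)$. Put $\deg t=\max_l\deg t_l$, and let $\|p\|_2$ be the $2$-norm of the coefficient vector of $p$. We say that the *essential ncKKT conditions hold at $\sigma^\star$* if for every $k\in\mathbb N$ and all reals $\epsilon_1,\dots,\epsilon_m>0$ there are Hermitian linear functionals $\mu_i,\lambda_j:\mathcal P_{2k}\to\mathbb C$ ($1\le i\le m$, $1\le j\le m'$) such that 1. $\mu_i(pp^*)+\epsilon_i\|p\|_2^2\ge0$ for all $i$ and all $p$ with $\deg p\le k$; 2. $\mu_i(pg_lp^*)+\epsilon_i\|p\|_2^2\ge0$ for all $i,l$ and all $p$ with $\deg p\le k-\lceil \deg(g_l)/2\rceil$; 3. $\mu_i(s^+h_js^-)=0$ for all $i,j$ and all $s^\pm$ with $\deg s^++\deg s^-\le 2k-\deg h_j$; 4. $\mu_i(sg_i)=\mu_i(g_is)=0$ for all $i$ and all $s$ with $\deg s\le 2k-\deg g_i$; 5. $\lambda_j(s^+h_ls^-)=0$ for all $j,l$ and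 all $s^\pm$ with $\deg s^++\deg s^-\le 2k-\deg h_l$; 6. $\sigma^\star(\nabla f(t))-\sum_i\mu_i(\nabla g_i(t))-\sum_j\lambda_j(\nabla h_j(t))=0$ for all $t\in\mathcal P^{n}$ such that $\deg(\nabla f)$, $\deg(\nabla g_i)$ and $\deg(\nabla h_j)$ are at most $2k-\deg t$ for all $i,j$. **Theorem.** The essential ncKKT conditions hold at every bounded minimizer $\sigma^\star$ of the NPO problem. In particular, if the problem is Archimedean, they hold at every minimizer. -/

import Mathlib

open scoped ComplexOrder

noncomputable section

namespace NPO

/-! ### Non-commutative polynomials -/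

/-- The unital algebra of complex polynomials in `n` non-commuting variables: finite linear
combinations of words in the letters `0, …, n - 1`. -/
abbrev NCPoly (n : ℕ) : Type := MonoidAlgebra ℂ (FreeMonoid (Fin n))

/-- The variable `x i`. -/
def var {n : ℕ} (i : Fin n) : NCPoly n := MonoidAlgebra.of ℂ (FreeMonoid (Fin n)) (FreeMonoid.of i)

/-- The involution: words are reversed (so the variables are Hermitian) and coefficients are
complex conjugated. -/
def adj {n : ℕ} (p : NCPoly n) : NCPoly n :=
  p.coeff.sum fun w c => MonoidAlgebra.single (star w) (star c)

theorem adj_single {n : ℕ} (w : FreeMonoid (Fin n)) (c : ℂ) :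
    adj (MonoidAlgebra.single w c) = MonoidAlgebra.single (star w) (star c) := by
  unfold adj
  rw [MonoidAlgebra.coeff_single, Finsupp.sum_single_index]
  simp

theorem adj_add {n : ℕ} (p q : NCPoly n) : adj (p + q) = adj p + adj q := by
  unfold adj
  rw [MonoidAlgebra.coeff_add, Finsupp.sum_add_index']
  · simp
  · intro w a b
    rw [star_add, MonoidAlgebra.single_add]

/-- The involution as an additive map. -/
def adjHom (n : ℕ) : NCPoly n →+ NCPoly n := AddMonoidHom.mk' adj adj_add

theorem adj_adj {n : ℕ} (p : NCPoly n) : adj (adj p) = p := by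
  have h : (adjHom n).comp (adjHom n) = AddMonoidHom.id _ := by
    refine MonoidAlgebra.addMonoidHom_ext ?_
    intro w c
    change adj (adj (MonoidAlgebra.single w c)) = MonoidAlgebra.single w c
    rw [adj_single, adj_single, star_star, star_star]
  exact DFunLike.congr_fun h p

theorem adj_mul {n : ℕ} (p q : NCPoly n) : adj (p * q) = adj q * adj p := by
  have h : (AddMonoidHom.mul (R := NCPoly n)).compr₂ (adjHom n) =
      ((AddMonoidHom.mul (R := NCPoly n)).flip.comp (adjHom n)).compl₂ (adjHom n) := by
    refine MonoidAlgebra.addMonoidHom_ext ?_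
    intro v a
    refine MonoidAlgebra.addMonoidHom_ext ?_
    intro w b
    change adj (MonoidAlgebra.single v a * MonoidAlgebra.single w b) =
      adj (MonoidAlgebra.single w b) * adj (MonoidAlgebra.single v a)
    rw [MonoidAlgebra.single_mul_single, adj_single, adj_single, adj_single,
      MonoidAlgebra.single_mul_single, star_mul, star_mul]
  exact DFunLike.congr_fun (DFunLike.congr_fun h p) q

instance (n : ℕ) : StarRing (NCPoly n) where
  star := adj
  star_involutive := adj_adj
  star_mul := adj_mul
  star_add := adj_add

theorem star_single {n : ℕ} (w : FreeMonoid (Fin n)) (c : ℂ) :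
    star (MonoidAlgebra.single w c : NCPoly n) = MonoidAlgebra.single (star w) (star c) :=
  adj_single w c

/-- The degree of a polynomial: the largest length of a word in its support (`0` for the zero
polynomial). -/
def degree {n : ℕ} (p : NCPoly n) : ℕ := p.coeff.support.sup FreeMonoid.length

/-- The degree of a tuple: the largest degree of its entries. -/
def tupleDegree {n : ℕ} (t : Fin n → NCPoly n) : ℕ := Finset.univ.sup fun i => degree (t i)

/-- The square `‖p‖₂²` of the 2-norm of the vector of coefficients of `p`. -/
def coeffNormSq {n : ℕ} (p : NCPoly n) : ℝ := ∑ w ∈ p.coeff.support, ‖p.coeff w‖ ^ 2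

theorem degree_le_iff {n : ℕ} (p : NCPoly n) (d : ℕ) :
    degree p ≤ d ↔ ∀ w ∈ p.coeff.support, w.length ≤ d := by
  simp [degree, Finset.sup_le_iff]

theorem degree_zero {n : ℕ} : degree (0 : NCPoly n) = 0 := by
  simp [degree]

theorem degree_single_le {n : ℕ} (w : FreeMonoid (Fin n)) (c : ℂ) :
    degree (MonoidAlgebra.single w c : NCPoly n) ≤ w.length := by
  rw [degree_le_iff]
  intro v hv
  rw [MonoidAlgebra.coeff_single] at hv
  have := Finsupp.support_single_subset hv
  rw [Finset.mem_singleton] at this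
  rw [this]

theorem degree_add_le {n d : ℕ} {p q : NCPoly n} (hp : degree p ≤ d) (hq : degree q ≤ d) :
    degree (p + q) ≤ d := by
  classical
  rw [degree_le_iff] at *
  intro w hw
  rw [MonoidAlgebra.coeff_add] at hw
  rcases Finset.mem_union.1 (Finsupp.support_add hw) with h | h
  · exact hp w h
  · exact hq w h

theorem degree_smul_le {n d : ℕ} (c : ℂ) {p : NCPoly n} (hp : degree p ≤ d) :
    degree (c • p) ≤ d := by
  rw [degree_le_iff] at *
  intro w hw
  rw [MonoidAlgebra.coeff_smul] at hw
  exact hp w (Finsupp.support_smul hw)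

theorem degree_sum_le {n d : ℕ} {ι : Type*} (s : Finset ι) (F : ι → NCPoly n)
    (h : ∀ i ∈ s, degree (F i) ≤ d) : degree (∑ i ∈ s, F i) ≤ d := by
  refine Finset.sum_induction F (fun p => degree p ≤ d) (fun _ _ => degree_add_le) ?_ h
  simp [degree_zero]

theorem eq_sum_single {n : ℕ} (p : NCPoly n) :
    p = ∑ w ∈ p.coeff.support, MonoidAlgebra.single w (p.coeff w) :=
  (MonoidAlgebra.sum_coeff_single p).symm

theorem degree_mul_le {n : ℕ} (p q : NCPoly n) : degree (p * q) ≤ degree p + degree q := by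
  conv_lhs => rw [eq_sum_single p, eq_sum_single q, Finset.sum_mul_sum]
  refine degree_sum_le _ _ fun v hv => degree_sum_le _ _ fun w hw => ?_
  rw [MonoidAlgebra.single_mul_single]
  refine (degree_single_le _ _).trans ?_
  rw [FreeMonoid.length_mul]
  exact add_le_add ((degree_le_iff p _).1 le_rfl v hv) ((degree_le_iff q _).1 le_rfl w hw)

theorem degree_star_le {n : ℕ} (p : NCPoly n) : degree (star p) ≤ degree p := by
  conv_lhs => rw [eq_sum_single p, star_sum]
  refine degree_sum_le _ _ fun w hw => ?_
  rw [star_single]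
  refine (degree_single_le _ _).trans ?_
  have h : (star w).length = w.length := List.length_reverse
  rw [h]
  exact (degree_le_iff p _).1 le_rfl w hw

theorem degree_mul_mul_le {n : ℕ} (p q r : NCPoly n) :
    degree (p * q * r) ≤ degree p + degree q + degree r :=
  (degree_mul_le _ _).trans (Nat.add_le_add_right (degree_mul_le _ _) _)

/-- The space of polynomials of degree at most `d`. -/
def polyLE (n d : ℕ) : Submodule ℂ (NCPoly n) where
  carrier := {p | degree p ≤ d}
  add_mem' := degree_add_le
  zero_mem' := by simp [degree_zero]
  smul_mem' c _ hp := degree_smul_le c hp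

/-! ### Gradients -/

/-- The gradient `∇p(t)`: the coefficient of `ε` in `p(x + ε t)`, where `ε` is a formal central
variable with `ε² = 0`. -/
def grad {n : ℕ} (p : NCPoly n) (t : Fin n → NCPoly n) : NCPoly n :=
  TrivSqZeroExt.snd
    (MonoidAlgebra.lift ℂ (DualNumber (NCPoly n)) (FreeMonoid (Fin n))
      (FreeMonoid.lift fun i => TrivSqZeroExt.inl (var i) + TrivSqZeroExt.inr (t i)) p)

/-- The degree of the gradient of `p`: writing `∇p(t) = ∑ s⁺ * t l * s⁻` by replacing in turn each
letter (at position `j`) of each word `w` of `p` by the corresponding entry of `t`, it is the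
largest value of `deg s⁺ + deg s⁻`. -/
def gradDegree {n : ℕ} (p : NCPoly n) : ℕ :=
  p.coeff.support.sup fun w =>
    (Finset.range w.length).sup fun j =>
      (w.toList.take j).length + (w.toList.drop (j + 1)).length

theorem degree_grad_word_le {n : ℕ} (t : Fin n → NCPoly n) (w : FreeMonoid (Fin n)) :
    TrivSqZeroExt.fst (FreeMonoid.lift (fun i =>
        (TrivSqZeroExt.inl (var i) + TrivSqZeroExt.inr (t i) : DualNumber (NCPoly n))) w) =
      MonoidAlgebra.single w 1 ∧
    degree (TrivSqZeroExt.snd (FreeMonoid.lift (fun i =>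
        (TrivSqZeroExt.inl (var i) + TrivSqZeroExt.inr (t i) : DualNumber (NCPoly n))) w)) ≤
      (w.length - 1) + tupleDegree t := by
  induction w using FreeMonoid.inductionOn' with
  | one => simp [degree_zero, MonoidAlgebra.one_def]
  | of_mul i w ih =>
    obtain ⟨h1, h2⟩ := ih
    have ht : degree (t i) ≤ tupleDegree t :=
      Finset.le_sup (f := fun i => degree (t i)) (Finset.mem_univ i)
    rw [map_mul, FreeMonoid.lift_eval_of]
    constructor
    · rw [TrivSqZeroExt.fst_mul, h1]
      simp [var, MonoidAlgebra.single_mul_single]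
    · rw [DualNumber.snd_mul, h1]
      simp only [TrivSqZeroExt.fst_add, TrivSqZeroExt.fst_inl, TrivSqZeroExt.fst_inr, add_zero,
        TrivSqZeroExt.snd_add, TrivSqZeroExt.snd_inl, TrivSqZeroExt.snd_inr, zero_add]
      rw [FreeMonoid.length_mul, FreeMonoid.length_of]
      have hv : degree (var i) ≤ 1 := degree_single_le _ _
      refine degree_add_le ?_ ?_
      · by_cases hw : w.length = 0
        · have : w = 1 := FreeMonoid.length_eq_zero.1 hw
          subst this
          simp [degree_zero]
        · refine (degree_mul_le _ _).trans ?_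
          omega
      · refine (degree_mul_le _ _).trans ?_
        have := degree_single_le w (1 : ℂ)
        omega

theorem length_sub_one_le_gradDegree {n : ℕ} (p : NCPoly n) (w : FreeMonoid (Fin n))
    (hw : w ∈ p.coeff.support) : w.length - 1 ≤ gradDegree p := by
  by_cases h : w.length = 0
  · omega
  · refine le_trans ?_ (Finset.le_sup hw)
    refine le_trans ?_ (Finset.le_sup (Finset.mem_range.2 (Nat.pos_of_ne_zero h)))
    simp [FreeMonoid.length]

theorem degree_grad_le {n : ℕ} (p : NCPoly n) (t : Fin n → NCPoly n) :
    degree (grad p t) ≤ gradDegree p + tupleDegree t := by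
  unfold grad
  conv_lhs => rw [eq_sum_single p, map_sum, TrivSqZeroExt.snd_sum]
  refine degree_sum_le _ _ fun w hw => ?_
  rw [MonoidAlgebra.lift_single, TrivSqZeroExt.snd_smul]
  refine degree_smul_le _ ((degree_grad_word_le t w).2.trans ?_)
  exact Nat.add_le_add_right (length_sub_one_le_gradDegree p w hw) _

/-! ### Optimization problems -/

/-- A non-commutative polynomial optimization problem in `n` variables: minimize `f` subject to the
`m` inequality constraints `g i ≥ 0` and the `m'` equality constraints `h j = 0`, where all
polynomials are Hermitian. -/
structure Problem (n m m' : ℕ) where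
  f : NCPoly n
  g : Fin m → NCPoly n
  h : Fin m' → NCPoly n
  f_hermitian : IsSelfAdjoint f
  g_hermitian : ∀ i, IsSelfAdjoint (g i)
  h_hermitian : ∀ j, IsSelfAdjoint (h j)

/-- Feasible functionals. The order of `ℂ` is used: `0 ≤ z` means that `z` is a nonnegative real. -/
structure Problem.IsFeasible {n m m' : ℕ} (P : Problem n m m') (σ : NCPoly n →ₗ[ℂ] ℂ) : Prop where
  map_one : σ 1 = 1
  nonneg : ∀ p, 0 ≤ σ (p * star p)
  ineq : ∀ i p, 0 ≤ σ (p * P.g i * star p)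
  eq : ∀ j p q, σ (p * P.h j * q) = 0

/-- Minimizers of `σ(f)` (a real number, for feasible `σ`) over all feasible functionals. -/
def Problem.IsMinimizer {n m m' : ℕ} (P : Problem n m m') (σ : NCPoly n →ₗ[ℂ] ℂ) : Prop :=
  P.IsFeasible σ ∧ ∀ τ : NCPoly n →ₗ[ℂ] ℂ, P.IsFeasible τ → (σ P.f).re ≤ (τ P.f).re

/-- The norm `‖[p]‖ = σ(p* p)^{1/2}` of the class of `p` in the GNS space of `σ`. -/
def gnsNorm {n : ℕ} (σ : NCPoly n →ₗ[ℂ] ℂ) (p : NCPoly n) : ℝ := √(σ (star p * p)).re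

/-- The GNS construction of `σ` generates bounded operators: for every `i`, the operator
`[p] ↦ [x i * p]`, densely defined on the GNS space of `σ`, is bounded. -/
def IsBounded {n : ℕ} (σ : NCPoly n →ₗ[ℂ] ℂ) : Prop :=
  ∀ i : Fin n, ∃ C : ℝ, ∀ p : NCPoly n, gnsNorm σ (var i * p) ≤ C * gnsNorm σ p

/-- `p` admits a (weighted) sum-of-squares decomposition
`p = ∑ s* s + ∑ᵢ ∑ s* gᵢ s + ∑ⱼ ∑ (s⁺ hⱼ (s⁻)* + s⁻ hⱼ (s⁺)*)`, all sums being finite. -/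
def Problem.IsSOS {n m m' : ℕ} (P : Problem n m m') (p : NCPoly n) : Prop :=
  ∃ (S : List (NCPoly n)) (T : Fin m → List (NCPoly n)) (U : Fin m' → List (NCPoly n × NCPoly n)),
    p = (S.map fun s => star s * s).sum
      + ∑ i, ((T i).map fun s => star s * P.g i * s).sum
      + ∑ j, ((U j).map fun s => s.1 * P.h j * star s.2 + s.2 * P.h j * star s.1).sum

/-- The Archimedean property: `K - ∑ xᵢ²` admits a sum-of-squares decomposition for some `K > 0`. -/
def Problem.IsArchimedean {n m m' : ℕ} (P : Problem n m m') : Prop :=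
  ∃ K : ℝ, 0 < K ∧ P.IsSOS (algebraMap ℂ (NCPoly n) (K : ℂ) - ∑ i, var i ^ 2)

/-! ### The essential optimality conditions -/

/-- A linear functional on polynomials of degree at most `d` is Hermitian if `μ(p*)` is the complex
conjugate of `μ(p)`. -/
def IsHermitianFunctional {n d : ℕ} (μ : polyLE n d →ₗ[ℂ] ℂ) : Prop :=
  ∀ (p : NCPoly n) (hp : degree p ≤ d),
    μ ⟨star p, (degree_star_le p).trans hp⟩ = star (μ ⟨p, hp⟩)

/-- `μ(s⁺ h s⁻) = 0` whenever `deg s⁺ + deg s⁻ ≤ d - deg h`. -/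
def Annihilates {n d : ℕ} (μ : polyLE n d →ₗ[ℂ] ℂ) (h : NCPoly n) : Prop :=
  ∀ (s s' : NCPoly n) (hs : degree s + degree h + degree s' ≤ d),
    μ ⟨s * h * s', (degree_mul_mul_le s h s').trans hs⟩ = 0

/-- `μ(s g) = μ(g s) = 0` whenever `deg s ≤ d - deg g`. -/
def ComplementarySlackness {n d : ℕ} (μ : polyLE n d →ₗ[ℂ] ℂ) (g : NCPoly n) : Prop :=
  ∀ (s : NCPoly n) (hs : degree s + degree g ≤ d),
    μ ⟨s * g, (degree_mul_le s g).trans hs⟩ = 0 ∧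
    μ ⟨g * s, (degree_mul_le g s).trans ((Nat.add_comm _ _).trans_le hs)⟩ = 0

/-- `μ(p p*) + ε ‖p‖₂² ≥ 0` whenever `deg p ≤ k`: the moment matrix of `μ` is `ε`-close to
positive semidefinite. -/
def MomentCondition {n k : ℕ} (μ : polyLE n (2 * k) →ₗ[ℂ] ℂ) (ε : ℝ) : Prop :=
  ∀ (p : NCPoly n) (hp : degree p ≤ k),
    0 ≤ μ ⟨p * star p, by
      have h1 := degree_mul_le p (star p)
      have h2 := degree_star_le p
      change degree (p * star p) ≤ 2 * k
      omega⟩ + ((ε * coeffNormSq p : ℝ) : ℂ)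

/-- `μ(p g p*) + ε ‖p‖₂² ≥ 0` whenever `deg p ≤ k - ⌈deg g / 2⌉`: the localizing matrix of `μ` for
the constraint `g ≥ 0` is `ε`-close to positive semidefinite. (`(d + 1) / 2` is `⌈d / 2⌉`.) -/
def LocalizingCondition {n k : ℕ} (μ : polyLE n (2 * k) →ₗ[ℂ] ℂ) (ε : ℝ) (g : NCPoly n) : Prop :=
  ∀ (p : NCPoly n) (hp : degree p + (degree g + 1) / 2 ≤ k),
    0 ≤ μ ⟨p * g * star p, by
      have h1 := degree_mul_mul_le p g (star p)
      have h2 := degree_star_le p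
      change degree (p * g * star p) ≤ 2 * k
      omega⟩ + ((ε * coeffNormSq p : ℝ) : ℂ)

/-- The truncated stationarity equation
`σ(∇f(t)) - ∑ᵢ μᵢ(∇gᵢ(t)) - ∑ⱼ λⱼ(∇hⱼ(t)) = 0`, for all tuples `t` with
`deg ∇f, deg ∇gᵢ, deg ∇hⱼ ≤ d - deg t`. -/
def Problem.Stationarity {n m m' d : ℕ} (P : Problem n m m') (σ : NCPoly n →ₗ[ℂ] ℂ)
    (μ : Fin m → polyLE n d →ₗ[ℂ] ℂ) (lam : Fin m' → polyLE n d →ₗ[ℂ] ℂ) : Prop :=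
  ∀ (t : Fin n → NCPoly n) (_ : gradDegree P.f + tupleDegree t ≤ d)
    (hg : ∀ i, gradDegree (P.g i) + tupleDegree t ≤ d)
    (hh : ∀ j, gradDegree (P.h j) + tupleDegree t ≤ d),
    σ (grad P.f t)
      - ∑ i, μ i ⟨grad (P.g i) t, (degree_grad_le _ _).trans (hg i)⟩
      - ∑ j, lam j ⟨grad (P.h j) t, (degree_grad_le _ _).trans (hh j)⟩ = 0

/-- The essential optimality conditions at the functional `σ`. -/
def Problem.EssentialKKTAt {n m m' : ℕ} (P : Problem n m m') (σ : NCPoly n →ₗ[ℂ] ℂ) : Prop :=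
  ∀ (k : ℕ) (ε : Fin m → ℝ), (∀ i, 0 < ε i) →
    ∃ (μ : Fin m → polyLE n (2 * k) →ₗ[ℂ] ℂ) (lam : Fin m' → polyLE n (2 * k) →ₗ[ℂ] ℂ),
      (∀ i, IsHermitianFunctional (μ i)) ∧
      (∀ j, IsHermitianFunctional (lam j)) ∧
      (∀ i, MomentCondition (μ i) (ε i)) ∧
      (∀ i l, LocalizingCondition (μ i) (ε i) (P.g l)) ∧
      (∀ i j, Annihilates (μ i) (P.h j)) ∧
      (∀ i, ComplementarySlackness (μ i) (P.g i)) ∧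
      (∀ j l, Annihilates (lam j) (P.h l)) ∧
      P.Stationarity σ μ lam

/-- A problem satisfies the essential ncKKT conditions if they hold at each of its minimizers. -/
def Problem.EssentialNcKKT {n m m' : ℕ} (P : Problem n m m') : Prop :=
  ∀ σ : NCPoly n →ₗ[ℂ] ℂ, P.IsMinimizer σ → P.EssentialKKTAt σ

end NPO

end

noncomputable section

namespace NPO

section Algebra

variable {n : ℕ}

theorem single_eq_smul (w : FreeMonoid (Fin n)) (c : ℂ) :
    (MonoidAlgebra.single w c : NCPoly n) = c • MonoidAlgebra.of ℂ (FreeMonoid (Fin n)) w := by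
  simp [MonoidAlgebra.of_apply, MonoidAlgebra.smul_single]

/-- Induction on polynomials, adding letters on the left. -/
theorem poly_induction {M : NCPoly n → Prop} (p : NCPoly n) (one : M 1)
    (var_mul : ∀ i p, M p → M (var i * p)) (add : ∀ p q, M p → M q → M (p + q))
    (smul : ∀ (c : ℂ) p, M p → M (c • p)) : M p := by
  have hw : ∀ w : FreeMonoid (Fin n), M (MonoidAlgebra.of ℂ (FreeMonoid (Fin n)) w) := by
    intro w
    induction w using FreeMonoid.inductionOn' with
    | one => rw [map_one]; exact one
    | of_mul i w ih => rw [map_mul]; exact var_mul i _ ih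
  rw [eq_sum_single p]
  refine Finset.sum_induction _ M add ?_ fun w _ => ?_
  · simpa using smul 0 1 one
  · rw [single_eq_smul]
    exact smul _ _ (hw w)

theorem star_smul_poly (c : ℂ) (p : NCPoly n) : star (c • p) = star c • star p := by
  have h : (adjHom n).comp (DistribSMul.toAddMonoidHom (NCPoly n) c) =
      (DistribSMul.toAddMonoidHom (NCPoly n) (star c)).comp (adjHom n) := by
    refine MonoidAlgebra.addMonoidHom_ext fun w a => ?_
    change adj (c • MonoidAlgebra.single w a) = star c • adj (MonoidAlgebra.single w a)
    rw [MonoidAlgebra.smul_single, adj_single, adj_single, MonoidAlgebra.smul_single]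
    simp
  exact DFunLike.congr_fun h p

instance : StarModule ℂ (NCPoly n) := ⟨star_smul_poly⟩

theorem star_var (i : Fin n) : star (var i : NCPoly n) = var i := by
  rw [var, MonoidAlgebra.of_apply, star_single]
  simp only [star_one]
  rfl

/-- The homomorphism `p ↦ p (x + ε t)`. -/
def perturb (t : Fin n → NCPoly n) : NCPoly n →ₐ[ℂ] DualNumber (NCPoly n) :=
  MonoidAlgebra.lift ℂ (DualNumber (NCPoly n)) (FreeMonoid (Fin n))
    (FreeMonoid.lift fun i => TrivSqZeroExt.inl (var i) + TrivSqZeroExt.inr (t i))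

theorem grad_eq_snd_perturb (p : NCPoly n) (t : Fin n → NCPoly n) :
    grad p t = (perturb t p).snd := rfl

theorem perturb_var (t : Fin n → NCPoly n) (i : Fin n) :
    perturb t (var i) = TrivSqZeroExt.inl (var i) + TrivSqZeroExt.inr (t i) := by
  exact (MonoidAlgebra.lift_of _ _).trans (FreeMonoid.lift_eval_of _ _)

theorem fst_perturb (t : Fin n → NCPoly n) (p : NCPoly n) : (perturb t p).fst = p := by
  induction p using poly_induction with
  | one => simp
  | var_mul i p ih => rw [map_mul, TrivSqZeroExt.fst_mul, ih, perturb_var]; simp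
  | add p q hp hq => rw [map_add, TrivSqZeroExt.fst_add, hp, hq]
  | smul c p hp => rw [map_smul, TrivSqZeroExt.fst_smul, hp]

theorem grad_add (p q : NCPoly n) (t : Fin n → NCPoly n) :
    grad (p + q) t = grad p t + grad q t := by
  simp [grad_eq_snd_perturb]

theorem grad_smul (c : ℂ) (p : NCPoly n) (t : Fin n → NCPoly n) :
    grad (c • p) t = c • grad p t := by
  simp [grad_eq_snd_perturb]

theorem grad_one (t : Fin n → NCPoly n) : grad 1 t = 0 := by
  simp [grad_eq_snd_perturb]

theorem grad_var (i : Fin n) (t : Fin n → NCPoly n) : grad (var i) t = t i := by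
  simp [grad_eq_snd_perturb, perturb_var]

theorem grad_mul (p q : NCPoly n) (t : Fin n → NCPoly n) :
    grad (p * q) t = p * grad q t + grad p t * q := by
  simp only [grad_eq_snd_perturb, map_mul, DualNumber.snd_mul, fst_perturb]

theorem grad_tuple_add (p : NCPoly n) (t u : Fin n → NCPoly n) :
    grad p (t + u) = grad p t + grad p u := by
  induction p using poly_induction with
  | one => simp [grad_one]
  | var_mul i p ih => simp only [grad_mul, grad_var, ih, Pi.add_apply]; noncomm_ring
  | add p q hp hq => simp only [grad_add, hp, hq]; abel
  | smul c p hp => simp only [grad_smul, hp, smul_add]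

theorem grad_tuple_smul (p : NCPoly n) (c : ℂ) (t : Fin n → NCPoly n) :
    grad p (c • t) = c • grad p t := by
  induction p using poly_induction with
  | one => simp [grad_one]
  | var_mul i p ih =>
    simp only [grad_mul, grad_var, ih, Pi.smul_apply, smul_add, mul_smul_comm, smul_mul_assoc]
  | add p q hp hq => simp only [grad_add, hp, hq, smul_add]
  | smul a p hp => simp only [grad_smul, hp, smul_comm a c]

theorem grad_star (p : NCPoly n) (t : Fin n → NCPoly n) :
    grad (star p) (star t) = star (grad p t) := by
  induction p using poly_induction with
  | one => simp [grad_one]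
  | var_mul i p ih =>
    simp only [star_mul, star_var, grad_mul, grad_var, ih, star_add, Pi.star_apply]
    abel
  | add p q hp hq => simp only [star_add, grad_add, hp, hq]
  | smul a p hp => simp only [star_smul, grad_smul, hp]

/-- Evaluation of polynomials at a tuple of elements of an algebra. -/
def eval {A : Type*} [Ring A] [Algebra ℂ A] (X : Fin n → A) : NCPoly n →ₐ[ℂ] A :=
  MonoidAlgebra.lift ℂ A (FreeMonoid (Fin n)) (FreeMonoid.lift X)

theorem eval_var {A : Type*} [Ring A] [Algebra ℂ A] (X : Fin n → A) (i : Fin n) :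
    eval X (var i) = X i := by
  rw [eval, var, MonoidAlgebra.lift_of, FreeMonoid.lift_eval_of]

theorem eval_star {A : Type*} [Ring A] [StarRing A] [Algebra ℂ A] [StarModule ℂ A]
    {X : Fin n → A} (hX : ∀ i, star (X i) = X i) (p : NCPoly n) :
    eval X (star p) = star (eval X p) := by
  induction p using poly_induction with
  | one => simp
  | var_mul i p ih => simp only [star_mul, map_mul, star_var, ih, eval_var, hX]
  | add p q hp hq => simp only [star_add, map_add, hp, hq]
  | smul c p hp => simp only [star_smul, map_smul, hp]

end Algebra

section Ideals

variable {n m m' : ℕ} (P : Problem n m m')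

/-- The two-sided ideal generated by the equality constraints. -/
def Problem.eqIdeal : Submodule ℂ (NCPoly n) :=
  Submodule.span ℂ {u | ∃ j a b, u = a * P.h j * b}

theorem Problem.mul_h_mul_mem_eqIdeal (j : Fin m') (a b : NCPoly n) :
    a * P.h j * b ∈ P.eqIdeal :=
  Submodule.subset_span ⟨j, a, b, rfl⟩

theorem Problem.star_mem_eqIdeal {u : NCPoly n} (hu : u ∈ P.eqIdeal) : star u ∈ P.eqIdeal := by
  induction hu using Submodule.span_induction with
  | mem u hu =>
    obtain ⟨j, a, b, rfl⟩ := hu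
    rw [star_mul, star_mul, P.h_hermitian j, ← mul_assoc]
    exact P.mul_h_mul_mem_eqIdeal j _ _
  | zero => simp
  | add u v _ _ hu hv => rw [star_add]; exact add_mem hu hv
  | smul c u _ hu => rw [star_smul]; exact P.eqIdeal.smul_mem _ hu

/-- The weights of the sums of squares: `1` and the inequality constraints. -/
def Problem.weight : Option (Fin m) → NCPoly n := fun l => l.elim 1 P.g

/-- The cone of finite sums of terms `p * p*` and `p * g l * p*`. -/
def Problem.sosCone : AddSubmonoid (NCPoly n) :=
  AddSubmonoid.closure {u | ∃ l p, u = p * P.weight l * star p}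

theorem Problem.weight_hermitian (l : Option (Fin m)) : star (P.weight l) = P.weight l := by
  cases l with
  | none => simp [weight]
  | some l => exact P.g_hermitian l

theorem Problem.mul_weight_mul_mem_sosCone (l : Option (Fin m)) (p : NCPoly n) :
    p * P.weight l * star p ∈ P.sosCone :=
  AddSubmonoid.subset_closure ⟨l, p, rfl⟩

theorem Problem.smul_mem_sosCone {r : ℝ} (hr : 0 ≤ r) {u : NCPoly n} (hu : u ∈ P.sosCone) :
    (r : ℂ) • u ∈ P.sosCone := by
  induction hu using AddSubmonoid.closure_induction with
  | mem u hu =>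
    obtain ⟨l, p, rfl⟩ := hu
    have : (r : ℂ) • (p * P.weight l * star p) =
        (((√r : ℝ) : ℂ) • p) * P.weight l * star (((√r : ℝ) : ℂ) • p) := by
      rw [star_smul, smul_mul_assoc, smul_mul_assoc, mul_smul_comm, smul_smul]
      congr 1
      simp only [RCLike.star_def, Complex.conj_ofReal, ← Complex.ofReal_mul,
        Real.mul_self_sqrt hr]
    rw [this]
    exact P.mul_weight_mul_mem_sosCone l _
  | zero => simp
  | add u v _ _ hu hv => rw [smul_add]; exact add_mem hu hv

theorem Problem.star_eq_of_mem_sosCone {u : NCPoly n} (hu : u ∈ P.sosCone) : star u = u := by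
  induction hu using AddSubmonoid.closure_induction with
  | mem u hu =>
    obtain ⟨l, p, rfl⟩ := hu
    rw [star_mul, star_mul, star_star, P.weight_hermitian, mul_assoc]
  | zero => simp
  | add u v _ _ hu hv => rw [star_add, hu, hv]

end Ideals

section Invariance

open Set Filter Topology Metric

/-- A closed set is invariant under a flow which is tangent to it up to second order. -/
theorem mem_of_quadratically_tangent {E : Type*} [NormedAddCommGroup E] [NormedSpace ℝ E]
    {C : Set E} (hC : IsClosed C) {a b K : ℝ} {x : ℝ → E} {v : ℝ → E → E}
    (hx : ContinuousOn x (Icc a b))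
    (hx' : ∀ s ∈ Ico a b, HasDerivWithinAt x (v s (x s)) (Ici s) s)
    (hv : ∀ s ∈ Ico a b, ∀ y, ‖v s (x s) - v s y‖ ≤ K * ‖x s - y‖)
    (htan : ∀ s ∈ Ico a b, ∃ M : ℝ, 0 ≤ M ∧ ∀ y ∈ C, ∀ h : ℝ, 0 < h →
      infDist (y + h • v s y) C ≤ M * h ^ 2 * ‖y‖)
    (ha : x a ∈ C) : ∀ s ∈ Icc a b, x s ∈ C := by
  have hne : C.Nonempty := ⟨_, ha⟩
  have hcont : ContinuousOn (fun s => infDist (x s) C) (Icc a b) :=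
    (continuous_infDist_pt C).comp_continuousOn hx
  have hder : ∀ s ∈ Ico a b, ∀ r, K * infDist (x s) C < r →
      ∃ᶠ z in 𝓝[>] s, (z - s)⁻¹ * (infDist (x z) C - infDist (x s) C) < r := by
    intro s hs r hr
    obtain ⟨M, hM, hMt⟩ := htan s hs
    set d := infDist (x s) C with hd
    set η := (r - K * d) / 2 with hη
    have hη0 : 0 < η := by rw [hη]; linarith
    have hlittle : ∀ᶠ z in 𝓝[>] s, ‖x z - x s - (z - s) • v s (x s)‖ ≤ η * ‖z - s‖ :=
      (((hasDerivWithinAt_iff_isLittleO.1 (hx' s hs)).def hη0).filter_mono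
        (nhdsWithin_mono _ Ioi_subset_Ici_self))
    have hlim : Tendsto (fun z : ℝ => (z - s) * (M * (‖x s‖ + d + (z - s) ^ 2) + 1 + (z - s) * |K|))
        (𝓝[>] s) (𝓝 0) := by
      have : Continuous
          (fun z : ℝ => (z - s) * (M * (‖x s‖ + d + (z - s) ^ 2) + 1 + (z - s) * |K|)) := by
        fun_prop
      have h2 := (this.tendsto s).mono_left (nhdsWithin_le_nhds (s := Ioi s))
      simpa using h2
    have hsmall := hlim.eventually (gt_mem_nhds hη0)
    refine Eventually.frequently ?_
    filter_upwards [hlittle, hsmall, self_mem_nhdsWithin] with z hz1 hz2 hz3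
    have hz : 0 < z - s := sub_pos.2 hz3
    obtain ⟨y, hyC, hy⟩ : ∃ y ∈ C, dist (x s) y < d + (z - s) ^ 2 :=
      (infDist_lt_iff hne).1 (by rw [← hd]; nlinarith)
    rw [dist_eq_norm] at hy
    have hd0 : 0 ≤ d := infDist_nonneg
    have hyn : ‖y‖ ≤ ‖x s‖ + d + (z - s) ^ 2 := by
      have := norm_sub_norm_le y (x s)
      rw [norm_sub_rev] at this
      linarith
    have h1 : infDist (x z) C ≤ infDist (y + (z - s) • v s y) C +
        dist (x z) (y + (z - s) • v s y) := infDist_le_infDist_add_dist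
    have h2 : dist (x z) (y + (z - s) • v s y) ≤
        η * (z - s) + ‖x s - y‖ + (z - s) * (K * ‖x s - y‖) := by
      rw [dist_eq_norm]
      have e : x z - (y + (z - s) • v s y) = (x z - x s - (z - s) • v s (x s)) + (x s - y) +
          (z - s) • (v s (x s) - v s y) := by
        rw [smul_sub]; abel
      rw [e]
      refine (norm_add₃_le).trans ?_
      rw [norm_smul]
      rw [Real.norm_eq_abs, abs_of_pos hz] at *
      exact add_le_add (add_le_add hz1 le_rfl) (mul_le_mul_of_nonneg_left (hv s hs y) hz.le)
    have h3 := hMt y hyC (z - s) hz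
    have h4 : M * (z - s) ^ 2 * ‖y‖ ≤ M * (z - s) ^ 2 * (‖x s‖ + d + (z - s) ^ 2) :=
      mul_le_mul_of_nonneg_left hyn (by positivity)
    have h5 : K * ‖x s - y‖ ≤ K * d + |K| * (z - s) ^ 2 := by
      have hdy : d ≤ ‖x s - y‖ := by
        rw [← dist_eq_norm]; exact infDist_le_dist_of_mem hyC
      have : K * (‖x s - y‖ - d) ≤ |K| * (‖x s - y‖ - d) :=
        mul_le_mul_of_nonneg_right (le_abs_self K) (by linarith)
      have h6 : |K| * (‖x s - y‖ - d) ≤ |K| * (z - s) ^ 2 :=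
        mul_le_mul_of_nonneg_left (by linarith) (abs_nonneg K)
      linarith
    have h7 := mul_le_mul_of_nonneg_left h5 hz.le
    rw [inv_mul_lt_iff₀ hz]
    have h8 := mul_lt_mul_of_pos_left hz2 hz
    have h9 : r = K * d + 2 * η := by rw [hη]; ring
    rw [h9]
    nlinarith
  intro s hs
  have := le_gronwallBound_of_liminf_deriv_right_le (δ := 0) (ε := 0) (K := K) hcont hder
    (infDist_zero_of_mem ha).le (fun s _ => by simp) s hs
  rw [gronwallBound_ε0_δ0] at this
  exact (hC.mem_iff_infDist_zero hne).2 (le_antisymm this infDist_nonneg)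

end Invariance

section Flow

open Set Filter Topology

variable {n m m' : ℕ}

section NormedAlgebra

variable {A : Type*} [NormedRing A] [NormedAlgebra ℂ A]

theorem contDiff_eval (p : NCPoly n) : ContDiff ℝ 1 fun X : Fin n → A => eval X p := by
  induction p using poly_induction with
  | one => simpa using contDiff_const
  | var_mul i p ih =>
    simp only [map_mul, eval_var]
    exact (contDiff_apply ℝ A i).mul ih
  | add p q hp hq => simpa only [map_add] using hp.add hq
  | smul c p hp => simpa only [map_smul] using hp.const_smul c

theorem continuous_eval (p : NCPoly n) : Continuous fun X : Fin n → A => eval X p :=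
  (contDiff_eval p).continuous

theorem hasDerivAt_eval {Y : ℝ → Fin n → A} {t : Fin n → NCPoly n} {s : ℝ}
    (hY : HasDerivAt Y (fun i => eval (Y s) (t i)) s) (p : NCPoly n) :
    HasDerivAt (fun r => eval (Y r) p) (eval (Y s) (grad p t)) s := by
  induction p using poly_induction with
  | one => simpa [grad_one] using hasDerivAt_const s (1 : A)
  | var_mul i p ih =>
    simp only [map_mul, eval_var, grad_mul, grad_var, map_add]
    rw [add_comm]
    exact (hasDerivAt_pi.1 hY i).mul ih
  | add p q hp hq =>
    simp only [map_add, grad_add]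
    exact hp.add hq
  | smul c p hp =>
    simp only [map_smul, grad_smul]
    exact hp.const_smul c

/-- Elements of the ideal of the equality constraints evaluate to linear functions of the values
of these constraints, depending continuously on the point. -/
theorem Problem.exists_eval_eq_of_mem_eqIdeal (P : Problem n m m') {u : NCPoly n}
    (hu : u ∈ P.eqIdeal) : ∃ L : (Fin n → A) → ((Fin m' → A) →L[ℂ] A), Continuous L ∧
      ∀ Y, eval Y u = L Y fun j => eval Y (P.h j) := by
  induction hu using Submodule.span_induction with
  | mem u hu =>
    obtain ⟨j, a, b, rfl⟩ := hu
    refine ⟨fun Y => (ContinuousLinearMap.mulLeftRight ℂ A (eval Y a) (eval Y b)).comp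
      (ContinuousLinearMap.proj j), ?_, fun Y => ?_⟩
    · have := continuous_eval (A := A) a
      have := continuous_eval (A := A) b
      fun_prop
    · simp [map_mul]
  | zero => exact ⟨0, continuous_const, fun Y => by simp⟩
  | add u v _ _ hu hv =>
    obtain ⟨L, hL, hL'⟩ := hu
    obtain ⟨N, hN, hN'⟩ := hv
    exact ⟨fun Y => L Y + N Y, hL.add hN, fun Y => by simp [hL', hN']⟩
  | smul c u _ hu =>
    obtain ⟨L, hL, hL'⟩ := hu
    exact ⟨fun Y => c • L Y, hL.const_smul c, fun Y => by simp [hL']⟩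

end NormedAlgebra

variable {A : Type*} [CStarAlgebra A]

/-- A Hermitian polynomial vector field has a local flow, which preserves self-adjointness. -/
theorem exists_selfAdjoint_flow {X : Fin n → A} (hX : ∀ i, star (X i) = X i)
    {t : Fin n → NCPoly n} (ht : star t = t) :
    ∃ T > 0, ∃ Y : ℝ → Fin n → A, Y 0 = X ∧
      (∀ s ∈ Icc 0 T, HasDerivAt Y (fun i => eval (Y s) (t i)) s) ∧
      ∀ s ∈ Icc 0 T, ∀ i, star (Y s i) = Y s i := by
  set v : (Fin n → A) → Fin n → A := fun Y i => eval Y (t i) with hv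
  have hvC : ContDiff ℝ 1 v := contDiff_pi.2 fun i => contDiff_eval (t i)
  obtain ⟨Y, hY0, ε, hε, hY⟩ :=
    hvC.contDiffAt.exists_forall_mem_closedBall_exists_eq_forall_mem_Ioo_hasDerivAt₀
      (x₀ := X) 0
  obtain ⟨K, U, hU, hK⟩ := (hvC.contDiffAt (x := X)).exists_lipschitzOnWith
  have hvstar : ∀ Z, v (star Z) = star (v Z) := by
    intro Z
    funext i
    have key : ∀ p : NCPoly n, eval (star Z) p = star (eval Z (star p)) := by
      intro p
      induction p using poly_induction with
      | one => simp
      | var_mul i p ih => simp [map_mul, star_mul, star_var, ih, eval_var]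
      | add p q hp hq => simp [hp, hq]
      | smul c p hp => simp [star_smul, hp]
    have hti : star (t i) = t i := congrFun ht i
    simp only [hv, key, hti, Pi.star_apply]
  have hmem : ∀ᶠ s in 𝓝 (0 : ℝ), HasDerivAt Y (v (Y s)) s := by
    filter_upwards [Ioo_mem_nhds (a := 0 - ε) (b := 0 + ε) (by linarith) (by linarith)] with s hs
    exact hY s hs
  have hYc : ContinuousAt Y 0 := (hmem.self_of_nhds).continuousAt
  have hXs : star X = X := funext hX
  have heq : Y =ᶠ[𝓝 0] fun s => star (Y s) := by
    refine ODE_solution_unique_of_eventually (v := fun _ => v) (s := fun _ => U)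
      (Eventually.of_forall fun _ => hK) ?_ ?_ ?_
    · refine hmem.and (hYc.eventually ?_)
      rwa [hY0]
    · refine Eventually.and ?_ ?_
      · filter_upwards [hmem] with s hs
        rw [hvstar]
        exact hasDerivAt_pi.2 fun i => (hasDerivAt_pi.1 hs i).star
      · have : ContinuousAt (fun s => star (Y s)) 0 := hYc.star
        refine this.eventually ?_
        change U ∈ 𝓝 (star (Y 0))
        rwa [hY0, hXs]
    · rw [hY0, hXs]
  obtain ⟨δ, hδ, hball⟩ := Metric.eventually_nhds_iff.1 (hmem.and heq)
  have hin : ∀ s ∈ Icc (0 : ℝ) (δ / 2), dist s 0 < δ := by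
    intro s hs
    rw [Real.dist_eq, sub_zero, abs_of_nonneg hs.1]
    linarith [hs.2]
  refine ⟨δ / 2, by positivity, Y, hY0, fun s hs => (hball (hin s hs)).1, fun s hs i => ?_⟩
  exact (congrFun (hball (hin s hs)).2 i).symm

/-- The equality constraints stay satisfied along a flow whose derivation preserves their ideal. -/
theorem Problem.eval_h_eq_zero_of_flow (P : Problem n m m') {t : Fin n → NCPoly n}
    (ht : ∀ j, grad (P.h j) t ∈ P.eqIdeal) {T : ℝ} {Y : ℝ → Fin n → A}
    (hY : ∀ s ∈ Icc 0 T, HasDerivAt Y (fun i => eval (Y s) (t i)) s)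
    (h0 : ∀ j, eval (Y 0) (P.h j) = 0) :
    ∀ s ∈ Icc 0 T, ∀ j, eval (Y s) (P.h j) = 0 := by
  choose L hL hL' using fun j => P.exists_eval_eq_of_mem_eqIdeal (A := A) (ht j)
  have hYc : ContinuousOn Y (Icc 0 T) := fun s hs => (hY s hs).continuousAt.continuousWithinAt
  obtain ⟨K, hK⟩ := isCompact_Icc.exists_bound_of_continuousOn
    (f := fun s => ∑ j, ‖L j (Y s)‖) (s := Icc 0 T)
    (continuousOn_finsetSum _ fun j _ => ((hL j).comp_continuousOn hYc).norm)
  have hder : ∀ s ∈ Icc 0 T, HasDerivAt (fun r j => eval (Y r) (P.h j))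
      (fun j => L j (Y s) fun j => eval (Y s) (P.h j)) s := by
    intro s hs
    refine hasDerivAt_pi.2 fun j => ?_
    rw [← hL']
    exact hasDerivAt_eval (hY s hs) (P.h j)
  have hzero := eq_zero_of_abs_deriv_le_mul_abs_self_of_eq_zero_right (K := K)
    (f := fun r j => eval (Y r) (P.h j))
    (f' := fun s j => L j (Y s) fun j => eval (Y s) (P.h j)) (a := 0) (b := T)
    (fun s hs => (hder s hs).continuousAt.continuousWithinAt)
    (fun s hs => (hder s (Ico_subset_Icc_self hs)).hasDerivWithinAt) (funext h0) ?_
  · exact fun s hs j => congrFun (hzero s hs) j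
  · intro s hs
    have hKs := (le_abs_self _).trans (hK s (Ico_subset_Icc_self hs))
    have hK0 : 0 ≤ K := (norm_nonneg _).trans (hK s (Ico_subset_Icc_self hs))
    refine (pi_norm_le_iff_of_nonneg (by positivity)).2 fun j => ?_
    refine ((L j (Y s)).le_opNorm _).trans (mul_le_mul_of_nonneg_right ?_ (norm_nonneg _))
    exact (Finset.single_le_sum (f := fun j => ‖L j (Y s)‖) (fun _ _ => norm_nonneg _)
      (Finset.mem_univ j)).trans hKs

variable [PartialOrder A] [StarOrderedRing A]

/-- Elements of the cone of weighted sums of squares evaluate to positive affine functions of the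
values of the inequality constraints, depending continuously on the point. -/
theorem Problem.exists_eval_eq_of_mem_sosCone (P : Problem n m m') {u : NCPoly n}
    (hu : u ∈ P.sosCone) : ∃ (Q : (Fin n → A) → A) (L : (Fin n → A) → ((Fin m → A) →L[ℂ] A)),
      Continuous L ∧ (∀ Y, (∀ i, star (Y i) = Y i) → 0 ≤ Q Y ∧
        (∀ G, 0 ≤ G → 0 ≤ L Y G) ∧ eval Y u = Q Y + L Y fun j => eval Y (P.g j)) := by
  induction hu using AddSubmonoid.closure_induction with
  | mem u hu =>
    obtain ⟨l, p, rfl⟩ := hu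
    cases l with
    | none =>
      refine ⟨fun Y => eval Y p * star (eval Y p), 0, continuous_const, fun Y hY => ⟨?_, ?_, ?_⟩⟩
      · exact mul_star_self_nonneg _
      · intro G _
        simp
      · simp [weight, map_mul, eval_star hY]
    | some l =>
      refine ⟨0, fun Y => (ContinuousLinearMap.mulLeftRight ℂ A (eval Y p) (eval Y (star p))).comp
        (ContinuousLinearMap.proj l), ?_, fun Y hY => ⟨le_rfl, fun G hG => ?_, ?_⟩⟩
      · have := continuous_eval (A := A) p
        have := continuous_eval (A := A) (star p)
        fun_prop
      · simpa [eval_star hY] using star_right_conjugate_nonneg (hG l) (eval Y p)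
      · simp [weight, map_mul]
  | zero => exact ⟨0, 0, continuous_const, fun Y _ => ⟨le_rfl, fun G _ => by simp, by simp⟩⟩
  | add u v _ _ hu hv =>
    obtain ⟨Q, L, hL, h⟩ := hu
    obtain ⟨R, N, hN, k⟩ := hv
    refine ⟨fun Y => Q Y + R Y, fun Y => L Y + N Y, hL.add hN, fun Y hY => ?_⟩
    obtain ⟨h1, h2, h3⟩ := h Y hY
    obtain ⟨k1, k2, k3⟩ := k Y hY
    refine ⟨add_nonneg h1 k1, fun G hG => add_nonneg (h2 G hG) (k2 G hG), ?_⟩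
    rw [map_add, h3, k3, add_apply]
    exact add_add_add_comm _ _ _ _

/-- The inequality constraints stay satisfied along a self-adjoint flow along which the equality
constraints are satisfied, provided that the derivatives of the inequality constraints are weighted
sums of squares up to terms `s * g + g * s*` and elements of the ideal. -/
theorem Problem.eval_g_nonneg_of_flow (P : Problem n m m') {t : Fin n → NCPoly n}
    {q r : Fin m → NCPoly n} (hq : ∀ i, q i ∈ P.sosCone)
    (ht : ∀ i, grad (P.g i) t - q i - (r i * P.g i + P.g i * star (r i)) ∈ P.eqIdeal)
    {T : ℝ} {Y : ℝ → Fin n → A}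
    (hY : ∀ s ∈ Icc 0 T, HasDerivAt Y (fun i => eval (Y s) (t i)) s)
    (hYs : ∀ s ∈ Icc 0 T, ∀ i, star (Y s i) = Y s i)
    (hh : ∀ s ∈ Icc 0 T, ∀ j, eval (Y s) (P.h j) = 0)
    (h0 : ∀ i, 0 ≤ eval (Y 0) (P.g i)) :
    ∀ s ∈ Icc 0 T, ∀ i, 0 ≤ eval (Y s) (P.g i) := by
  choose Q L hL hQL using fun i => P.exists_eval_eq_of_mem_sosCone (A := A) (hq i)
  choose N _ hN using fun i => P.exists_eval_eq_of_mem_eqIdeal (A := A) (ht i)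
  have hYc : ContinuousOn Y (Icc 0 T) := fun s hs => (hY s hs).continuousAt.continuousWithinAt
  set R : Fin m → ℝ → A := fun i s => eval (Y s) (r i) with hR
  have hRc : ∀ i, ContinuousOn (R i) (Icc 0 T) :=
    fun i => (continuous_eval (r i)).comp_continuousOn hYc
  set v : ℝ → (Fin m → A) → Fin m → A := fun s y i =>
    Q i (Y s) + L i (Y s) y + (R i s * y i + y i * star (R i s)) with hv
  obtain ⟨K, hK⟩ := isCompact_Icc.exists_bound_of_continuousOn
    (f := fun s => ∑ i, (‖L i (Y s)‖ + 2 * ‖R i s‖)) (s := Icc 0 T)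
    (continuousOn_finsetSum _ fun i _ =>
      ((hL i).comp_continuousOn hYc).norm.add (continuousOn_const.mul (hRc i).norm))
  have hder : ∀ s ∈ Icc 0 T, HasDerivAt (fun a i => eval (Y a) (P.g i))
      (v s fun i => eval (Y s) (P.g i)) s := by
    intro s hs
    refine hasDerivAt_pi.2 fun i => ?_
    have e : eval (Y s) (grad (P.g i) t) = v s (fun i => eval (Y s) (P.g i)) i := by
      have h1 := hN i (Y s)
      simp only [hh s hs] at h1
      have h2 : N i (Y s) (fun _ => (0 : A)) = 0 := map_zero (N i (Y s))
      rw [h2, map_sub, map_sub, sub_sub, sub_eq_zero] at h1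
      rw [h1, (hQL i (Y s) (hYs s hs)).2.2]
      simp only [hv, hR, map_add, map_mul, eval_star (hYs s hs)]
    rw [← e]
    exact hasDerivAt_eval (hY s hs) (P.g i)
  have hC : IsClosed {y : Fin m → A | ∀ i, 0 ≤ y i} := by
    simp only [ofPred_forall]
    exact isClosed_iInter fun i => CStarAlgebra.isClosed_nonneg.preimage (continuous_apply i)
  refine mem_of_quadratically_tangent hC (v := v) (K := K)
    (x := fun a i => eval (Y a) (P.g i))
    (fun s hs => (hder s hs).continuousAt.continuousWithinAt)
    (fun s hs => (hder s (Ico_subset_Icc_self hs)).hasDerivWithinAt) ?_ ?_ h0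
  · intro s hs y
    set x : Fin m → A := fun i => eval (Y s) (P.g i)
    have hKs := (le_abs_self _).trans (hK s (Ico_subset_Icc_self hs))
    have hK0 : 0 ≤ K := (norm_nonneg _).trans (hK s (Ico_subset_Icc_self hs))
    refine (pi_norm_le_iff_of_nonneg (by positivity)).2 fun i => ?_
    have e : (v s x - v s y) i =
        L i (Y s) (x - y) + (R i s * (x - y) i + (x - y) i * star (R i s)) := by
      simp only [hv, Pi.sub_apply, map_sub]
      noncomm_ring
    rw [e]
    have hxy := norm_le_pi_norm (x - y) i
    have b1 := (L i (Y s)).le_opNorm (x - y)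
    have b2 : ‖R i s * (x - y) i‖ ≤ ‖R i s‖ * ‖x - y‖ :=
      (norm_mul_le _ _).trans (mul_le_mul_of_nonneg_left hxy (norm_nonneg _))
    have b3 : ‖(x - y) i * star (R i s)‖ ≤ ‖R i s‖ * ‖x - y‖ := by
      refine (norm_mul_le _ _).trans ?_
      rw [norm_star, mul_comm]
      exact mul_le_mul_of_nonneg_left hxy (norm_nonneg _)
    have b4 := (Finset.single_le_sum (f := fun i => ‖L i (Y s)‖ + 2 * ‖R i s‖)
      (fun _ _ => by positivity) (Finset.mem_univ i)).trans hKs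
    calc _ ≤ ‖L i (Y s)‖ * ‖x - y‖ + (‖R i s‖ * ‖x - y‖ + ‖R i s‖ * ‖x - y‖) :=
          (norm_add_le _ _).trans (add_le_add b1 ((norm_add_le _ _).trans (add_le_add b2 b3)))
      _ = (‖L i (Y s)‖ + 2 * ‖R i s‖) * ‖x - y‖ := by ring
      _ ≤ K * ‖x - y‖ := mul_le_mul_of_nonneg_right b4 (norm_nonneg _)
  · intro s hs
    refine ⟨∑ i, ‖R i s‖ ^ 2, by positivity, fun y hy h hpos => ?_⟩
    obtain hQs := fun i => hQL i (Y s) (hYs s (Ico_subset_Icc_self hs))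
    set z : Fin m → A := fun i => h • (Q i (Y s) + L i (Y s) y) +
      (1 + h • R i s) * y i * star (1 + h • R i s) with hz
    have hzC : z ∈ {y : Fin m → A | ∀ i, 0 ≤ y i} := fun i =>
      add_nonneg (smul_nonneg hpos.le (add_nonneg (hQs i).1 ((hQs i).2.1 y hy)))
        (star_right_conjugate_nonneg (hy i) _)
    refine (Metric.infDist_le_dist_of_mem hzC).trans ?_
    rw [dist_eq_norm]
    refine (pi_norm_le_iff_of_nonneg (by positivity)).2 fun i => ?_
    have e : (y + h • v s y - z) i = -(h ^ 2 • (R i s * y i * star (R i s))) := by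
      simp only [hv, hz, Pi.sub_apply, Pi.add_apply, Pi.smul_apply, star_add, star_one, star_smul,
        smul_add, add_mul, mul_add, one_mul, mul_one, smul_mul_assoc, mul_smul_comm, smul_smul,
        star_trivial, pow_two]
      abel
    rw [e, norm_neg, norm_smul, Real.norm_of_nonneg (by positivity)]
    have b1 : ‖R i s * y i * star (R i s)‖ ≤ ‖R i s‖ ^ 2 * ‖y‖ := by
      calc _ ≤ ‖R i s‖ * ‖y i‖ * ‖star (R i s)‖ :=
            (norm_mul_le _ _).trans (mul_le_mul_of_nonneg_right (norm_mul_le _ _) (norm_nonneg _))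
        _ = ‖R i s‖ ^ 2 * ‖y i‖ := by rw [norm_star]; ring
        _ ≤ _ := mul_le_mul_of_nonneg_left (norm_le_pi_norm y i) (by positivity)
    have b2 : ‖R i s‖ ^ 2 ≤ ∑ i, ‖R i s‖ ^ 2 :=
      Finset.single_le_sum (f := fun i => ‖R i s‖ ^ 2) (fun _ _ => by positivity)
        (Finset.mem_univ i)
    calc _ ≤ h ^ 2 * (‖R i s‖ ^ 2 * ‖y‖) := mul_le_mul_of_nonneg_left b1 (by positivity)
      _ ≤ h ^ 2 * ((∑ i, ‖R i s‖ ^ 2) * ‖y‖) := by gcongr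
      _ = _ := by ring

end Flow

section GNS

open scoped InnerProductSpace

variable {n m m' : ℕ}

/-- A functional which is nonnegative on squares is Hermitian. -/
theorem map_star_of_nonneg {σ : NCPoly n →ₗ[ℂ] ℂ} (hσ : ∀ p, 0 ≤ σ (p * star p)) (p : NCPoly n) :
    σ (star p) = star (σ p) := by
  have im_zero : ∀ q, (σ (q * star q)).im = 0 := fun q => ((Complex.nonneg_iff.1 (hσ q)).2).symm
  have key : ∀ q : NCPoly n, (σ q + σ (star q)).im = 0 := by
    intro q
    have h1 := im_zero (1 + q)
    have h2 := im_zero q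
    have h3 := im_zero 1
    have e : (1 + q) * star (1 + q) = 1 * star 1 + (q + star q) + q * star q := by
      rw [star_add, star_one]; noncomm_ring
    rw [e, map_add, map_add, map_add, Complex.add_im, Complex.add_im, h2, h3] at h1
    linarith
  have h1 := key p
  have h2 := key (Complex.I • p)
  rw [star_smul, map_smul, map_smul] at h2
  simp at h1 h2
  apply Complex.ext
  · simp; linarith
  · simp; linarith

theorem exists_gns {σ : NCPoly n →ₗ[ℂ] ℂ} (hσ : ∀ p, 0 ≤ σ (p * star p)) (hb : IsBounded σ) :
    ∃ (H : Type) (_ : NormedAddCommGroup H) (_ : InnerProductSpace ℂ H) (_ : CompleteSpace H)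
      (X : Fin n → H →L[ℂ] H) (ι : NCPoly n →ₗ[ℂ] H), DenseRange ι ∧
      (∀ p q, ⟪ι p, ι q⟫_ℂ = σ (star p * q)) ∧ ∀ i p, X i (ι p) = ι (var i * p) := by
  let core : PreInnerProductSpace.Core ℂ (NCPoly n) :=
    { inner := fun p q => σ (star p * q)
      conj_inner_symm := fun p q => by
        rw [starRingEnd_apply, ← map_star_of_nonneg hσ, star_mul, star_star]
      re_inner_nonneg := fun p => by
        have := hσ (star p)
        rw [star_star] at this
        exact (Complex.nonneg_iff.1 this).1
      add_left := fun p q r => by rw [star_add, add_mul, map_add]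
      smul_left := fun p q c => by
        rw [star_smul, smul_mul_assoc, map_smul]
        rfl }
  let _ : SeminormedAddCommGroup (NCPoly n) :=
    InnerProductSpace.Core.toSeminormedAddCommGroup (c := core)
  let _ : InnerProductSpace ℂ (NCPoly n) := InnerProductSpace.ofCore core
  have hnorm : ∀ p : NCPoly n, ‖p‖ = gnsNorm σ p := fun p => rfl
  choose C hC using hb
  let L : Fin n → NCPoly n →L[ℂ] NCPoly n := fun i =>
    (LinearMap.mulLeft ℂ (var i)).mkContinuous (C i) fun p => by
      rw [hnorm, hnorm]; exact hC i p
  refine ⟨UniformSpace.Completion (NCPoly n), inferInstance, inferInstance, inferInstance,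
    fun i => (L i).completion,
    (UniformSpace.Completion.toComplL (𝕜 := ℂ) (E := NCPoly n)).toLinearMap, ?_, ?_, ?_⟩
  · exact UniformSpace.Completion.denseRange_coe
  · intro p q
    exact UniformSpace.Completion.inner_coe p q
  · intro i p
    simp [L]

end GNS

section Descent

open Set Filter Topology
open scoped InnerProductSpace

variable {n m m' : ℕ}

/-- A first-order descent direction cannot exist at a bounded minimizer: the objective does not
decrease along Hermitian vector fields whose flow preserves the constraints. -/
theorem Problem.IsMinimizer.re_grad_nonneg {P : Problem n m m'} {σ : NCPoly n →ₗ[ℂ] ℂ}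
    (hσ : P.IsMinimizer σ) (hb : IsBounded σ) {t : Fin n → NCPoly n} (ht : star t = t)
    {q r : Fin m → NCPoly n} (hq : ∀ i, q i ∈ P.sosCone)
    (hg : ∀ i, grad (P.g i) t - q i - (r i * P.g i + P.g i * star (r i)) ∈ P.eqIdeal)
    (hh : ∀ j, grad (P.h j) t ∈ P.eqIdeal) :
    0 ≤ (σ (grad P.f t)).re := by
  obtain ⟨hF, hmin⟩ := hσ
  obtain ⟨H, _, _, _, X, ι, hdense, hinner, hX⟩ := exists_gns hF.nonneg hb
  have heval : ∀ p q, eval X p (ι q) = ι (p * q) := by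
    intro p
    induction p using poly_induction with
    | one => simp
    | var_mul i p ih =>
      intro q
      rw [map_mul, eval_var, mul_assoc, ← hX, ← ih]
      rfl
    | add p p' hp hp' => intro q; rw [map_add, add_apply, hp, hp', add_mul, map_add]
    | smul c p hp =>
      intro q
      rw [map_smul, smul_apply, hp, smul_mul_assoc, map_smul]
  have hXstar : ∀ i, star (X i) = X i := by
    intro i
    rw [ContinuousLinearMap.star_eq_adjoint]
    symm
    rw [ContinuousLinearMap.eq_adjoint_iff]
    intro x y
    refine hdense.induction_on₂ (p := fun x y => ⟪X i x, y⟫_ℂ = ⟪x, X i y⟫_ℂ) ?_ ?_ x y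
    · exact isClosed_eq (by fun_prop) (by fun_prop)
    · intro p q
      rw [hX, hX, hinner, hinner, star_mul, star_var, mul_assoc]
  have hX0 : ∀ i, 0 ≤ eval X (P.g i) := by
    intro i
    rw [ContinuousLinearMap.nonneg_iff_isPositive, ContinuousLinearMap.isPositive_iff']
    refine ⟨?_, fun x => ?_⟩
    · rw [IsSelfAdjoint, ← eval_star hXstar, P.g_hermitian i]
    · refine hdense.induction_on (p := fun x => 0 ≤ ⟪eval X (P.g i) x, x⟫_ℂ) x ?_ fun p => ?_
      · have hc : Continuous fun x => ⟪eval X (P.g i) x, x⟫_ℂ := by fun_prop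
        exact isClosed_Ici.preimage hc
      · rw [heval, hinner, star_mul, P.g_hermitian i]
        simpa using hF.ineq i (star p)
  have hXh : ∀ j, eval X (P.h j) = 0 := by
    intro j
    ext x
    refine hdense.induction_on (p := fun x => eval X (P.h j) x = 0) x ?_ ?_
    · exact isClosed_eq (by fun_prop) (by fun_prop)
    · intro p
      rw [heval, ← inner_self_eq_zero (𝕜 := ℂ), hinner, ← mul_assoc]
      exact hF.eq j _ _
  obtain ⟨T, hT, Y, hY0, hY, hYs⟩ := exists_selfAdjoint_flow hXstar ht
  have hYh := P.eval_h_eq_zero_of_flow hh hY (by rwa [hY0])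
  have hYg := P.eval_g_nonneg_of_flow hq hg hY hYs hYh (by rwa [hY0])
  let ω : (H →L[ℂ] H) →L[ℂ] ℂ :=
    (innerSL ℂ (ι 1)).comp (ContinuousLinearMap.apply ℂ H (ι 1))
  have hω : ∀ B, ω B = ⟪ι 1, B (ι 1)⟫_ℂ := fun B => rfl
  have hωpos : ∀ B, 0 ≤ B → 0 ≤ ω B := by
    intro B hB
    rw [hω]
    exact ((ContinuousLinearMap.nonneg_iff_isPositive B).1 hB).inner_nonneg_right _
  have hωσ : ∀ p, ω (eval X p) = σ p := by
    intro p
    rw [hω, heval, hinner, mul_one, star_one, one_mul]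
  have hfeas : ∀ s ∈ Icc 0 T, P.IsFeasible (ω.toLinearMap ∘ₗ (eval (Y s)).toLinearMap) := by
    intro s hs
    refine ⟨?_, fun p => ?_, fun i p => ?_, fun j p q => ?_⟩
    · change ω (eval (Y s) 1) = 1
      rw [map_one, ← map_one (eval X), hωσ, hF.map_one]
    · change 0 ≤ ω (eval (Y s) (p * star p))
      rw [map_mul (eval (Y s)), eval_star (hYs s hs)]
      exact hωpos _ (mul_star_self_nonneg _)
    · change 0 ≤ ω (eval (Y s) (p * P.g i * star p))
      rw [map_mul (eval (Y s)), map_mul (eval (Y s)), eval_star (hYs s hs)]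
      exact hωpos _ (star_right_conjugate_nonneg (hYg s hs i) _)
    · change ω (eval (Y s) (p * P.h j * q)) = 0
      rw [map_mul (eval (Y s)), map_mul (eval (Y s)), hYh s hs j, mul_zero, zero_mul, map_zero]
  have hder : HasDerivAt (fun s => (ω (eval (Y s) P.f)).re) (σ (grad P.f t)).re 0 := by
    have h1 := hasDerivAt_eval (hY 0 ⟨le_rfl, hT.le⟩) P.f
    have h2 := ((Complex.reCLM.comp (ω.restrictScalars ℝ)).hasFDerivAt).comp_hasDerivAt 0 h1
    rw [← hωσ, ← hY0]
    exact h2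
  have hd := hasDerivWithinAt_iff_tendsto_slope' (by simp) |>.1 (hder.hasDerivWithinAt (s := Ioi 0))
  refine ge_of_tendsto hd ?_
  filter_upwards [Ioc_mem_nhdsGT hT] with s hs
  rw [slope_def_field]
  refine div_nonneg ?_ (by linarith [hs.1])
  rw [sub_nonneg, hY0, hωσ]
  exact hmin _ (hfeas s ⟨hs.1.le, hs.2⟩)

end Descent

section Archimedean

variable {n m m' : ℕ}

theorem Problem.IsFeasible.nonneg_of_isSOS {P : Problem n m m'} {σ : NCPoly n →ₗ[ℂ] ℂ}
    (hσ : P.IsFeasible σ) {u : NCPoly n} (hu : P.IsSOS u) (p : NCPoly n) :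
    0 ≤ σ (star p * u * p) := by
  have hlist : ∀ {κ : Type} (l : List κ) (F : κ → NCPoly n),
      (∀ s, 0 ≤ σ (star p * F s * p)) → 0 ≤ σ (star p * (l.map F).sum * p) := by
    intro κ l F hF
    induction l with
    | nil => simp
    | cons a l ih =>
      rw [List.map_cons, List.sum_cons, mul_add, add_mul, map_add]
      exact add_nonneg (hF a) ih
  obtain ⟨S, T, U, rfl⟩ := hu
  rw [mul_add, mul_add, add_mul, add_mul, map_add, map_add, Finset.mul_sum, Finset.mul_sum,
    Finset.sum_mul, Finset.sum_mul, map_sum, map_sum]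
  refine add_nonneg (add_nonneg (hlist S _ fun s => ?_)
    (Finset.sum_nonneg fun i _ => hlist (T i) _ fun s => ?_))
    (Finset.sum_nonneg fun j _ => hlist (U j) _ fun s => le_of_eq ?_)
  · simpa [mul_assoc] using hσ.nonneg (star p * star s)
  · simpa [mul_assoc] using hσ.ineq i (star p * star s)
  · have h1 := hσ.eq j (star p * s.1) (star s.2 * p)
    have h2 := hσ.eq j (star p * s.2) (star s.1 * p)
    rw [mul_add, add_mul, map_add]
    simp only [mul_assoc] at h1 h2 ⊢
    rw [h1, h2, add_zero]

theorem Problem.IsArchimedean.isBounded {P : Problem n m m'} (hP : P.IsArchimedean)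
    {σ : NCPoly n →ₗ[ℂ] ℂ} (hσ : P.IsFeasible σ) : IsBounded σ := by
  obtain ⟨K, hK, hSOS⟩ := hP
  intro i
  refine ⟨√K, fun p => ?_⟩
  have h := hσ.nonneg_of_isSOS hSOS p
  have hterm : ∀ j, 0 ≤ (σ (star (var j * p) * (var j * p))).re := by
    intro j
    have := hσ.nonneg (star (var j * p))
    rw [star_star] at this
    exact (Complex.nonneg_iff.1 this).1
  have e : star p * (algebraMap ℂ (NCPoly n) (K : ℂ) - ∑ j, var j ^ 2) * p =
      (K : ℂ) • (star p * p) - ∑ j, star (var j * p) * (var j * p) := by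
    have e' : ∀ j, star (var j * p) * (var j * p) = star p * var j ^ 2 * p := fun j => by
      rw [star_mul, star_var, pow_two]
      simp only [mul_assoc]
    simp only [e']
    rw [mul_sub, sub_mul, Algebra.algebraMap_eq_smul_one, mul_smul_comm, mul_one, smul_mul_assoc,
      Finset.mul_sum, Finset.sum_mul]
  rw [e, map_sub, map_sum, map_smul] at h
  have h1 := (Complex.nonneg_iff.1 h).1
  rw [Complex.sub_re, Complex.re_sum, smul_eq_mul, Complex.re_ofReal_mul] at h1
  have h2 := Finset.single_le_sum (f := fun j => (σ (star (var j * p) * (var j * p))).re)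
    (fun j _ => hterm j) (Finset.mem_univ i)
  rw [gnsNorm, gnsNorm, ← Real.sqrt_mul hK.le]
  exact Real.sqrt_le_sqrt (by linarith)

end Archimedean

section Separation

variable {E : Type*} [NormedAddCommGroup E] [NormedSpace ℝ E] [FiniteDimensional ℝ E]

theorem isCompact_convexHull {s : Set E} (hs : IsCompact s) : IsCompact (convexHull ℝ s) := by
  let F : ∀ N : ℕ, (Fin N → ℝ) × (Fin N → E) → E := fun N x => ∑ i, x.1 i • x.2 i
  have hF : ∀ N, Continuous (F N) := fun N => by fun_prop
  have h : convexHull ℝ s = ⋃ N : Fin (Module.finrank ℝ E + 2),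
      F N '' (stdSimplex ℝ (Fin N) ×ˢ Set.univ.pi fun _ => s) := by
    refine Set.Subset.antisymm (fun x hx => ?_) (Set.iUnion_subset fun N => ?_)
    · obtain ⟨κ, hκ, z, w, hz, hind, hw, hw1, rfl⟩ := eq_pos_convex_span_of_mem_convexHull hx
      have hcard : Fintype.card κ < Module.finrank ℝ E + 2 := by
        have h1 := hind.card_le_finrank_succ
        have h2 := Submodule.finrank_le (vectorSpan ℝ (Set.range z))
        omega
      have e := (Fintype.equivFin κ).symm
      refine Set.mem_iUnion.2 ⟨⟨Fintype.card κ, hcard⟩, (w ∘ e, z ∘ e), ⟨⟨fun i => (hw _).le, ?_⟩,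
        fun i _ => hz ⟨_, rfl⟩⟩, ?_⟩
      · rw [← hw1]
        exact e.sum_comp w
      · exact e.sum_comp fun i => w i • z i
    · rintro _ ⟨⟨w, z⟩, ⟨hw, hz⟩, rfl⟩
      exact (convex_convexHull ℝ s).sum_mem (fun i _ => hw.1 i) hw.2
        fun i _ => subset_convexHull ℝ s (hz i trivial)
  rw [h]
  exact isCompact_iUnion fun N =>
    ((isCompact_stdSimplex ℝ (Fin N)).prod (isCompact_univ_pi fun _ => hs)).image (hF N)

/-- Strict separation of a compact convex set from a subspace. -/
theorem exists_linear_pos_of_disjoint {s : Set E} (hs : IsCompact s) (hc : Convex ℝ s)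
    (W : Submodule ℝ E) (h : Disjoint s W) :
    ∃ F : E →ₗ[ℝ] ℝ, (∀ x ∈ W, F x = 0) ∧ ∀ x ∈ s, 0 < F x := by
  obtain ⟨F, u, v, hu, huv, hv⟩ := geometric_hahn_banach_compact_closed hc hs W.convex
    W.closed_of_finiteDimensional h
  have hv0 : v < 0 := by simpa using hv 0 W.zero_mem
  refine ⟨-F.toLinearMap, fun x hx => ?_, fun x hx => ?_⟩
  · by_contra hne
    have hne : F x ≠ 0 := by simpa using hne
    have := hv ((v / F x) • x) (W.smul_mem _ hx)
    rw [map_smul, smul_eq_mul, div_mul_cancel₀ _ hne] at this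
    exact lt_irrefl _ this
  · have := hu x hx
    simp
    linarith

end Separation

section Coordinates

variable {n : ℕ}

/-- Words of length at most `d`. -/
abbrev WordLE (n d : ℕ) : Type := {w : FreeMonoid (Fin n) // w.length ≤ d}

instance (d : ℕ) : Finite (WordLE n d) := (List.finite_length_le (Fin n) d).to_subtype

instance (d : ℕ) : Fintype (WordLE n d) := Fintype.ofFinite _

/-- The coefficients of a polynomial at the words of length at most `d`. -/
def coords (d : ℕ) : NCPoly n →ₗ[ℂ] (WordLE n d → ℂ) where
  toFun p w := p.coeff w
  map_add' p q := by ext w; simp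
  map_smul' c p := by ext w; simp

/-- The polynomial of degree at most `d` with given coefficients. -/
def ofCoords {d : ℕ} (c : WordLE n d → ℂ) : NCPoly n := ∑ w, MonoidAlgebra.single w.1 (c w)

theorem degree_ofCoords_le {d : ℕ} (c : WordLE n d → ℂ) : degree (ofCoords c) ≤ d :=
  degree_sum_le _ _ fun w _ => (degree_single_le _ _).trans w.2

theorem sum_support_eq_sum_wordLE {M : Type*} [AddCommMonoid M] {d : ℕ} {p : NCPoly n}
    (hp : degree p ≤ d) (F : FreeMonoid (Fin n) → M) (hF : ∀ w, p.coeff w = 0 → F w = 0) :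
    ∑ w ∈ p.coeff.support, F w = ∑ w : WordLE n d, F w := by
  have h : ∑ w : WordLE n d, F w = ∑ w ∈ (Finset.univ : Finset (WordLE n d)).map
      (Function.Embedding.subtype _), F w := by
    rw [Finset.sum_map]
    rfl
  rw [h]
  refine Finset.sum_subset (fun w hw => ?_) fun w _ hw => hF w (by simpa using hw)
  exact Finset.mem_map.2 ⟨⟨w, (degree_le_iff p d).1 hp w hw⟩, Finset.mem_univ _, rfl⟩

theorem ofCoords_coords {d : ℕ} {p : NCPoly n} (hp : degree p ≤ d) :
    ofCoords (coords d p) = p := by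
  conv_rhs => rw [eq_sum_single p]
  rw [sum_support_eq_sum_wordLE hp _ fun w hw => by rw [hw, MonoidAlgebra.single_zero]]
  rfl

theorem sum_norm_sq_coords {d : ℕ} {p : NCPoly n} (hp : degree p ≤ d) :
    ∑ w, ‖coords d p w‖ ^ 2 = coeffNormSq p :=
  (sum_support_eq_sum_wordLE hp (fun w => ‖p.coeff w‖ ^ 2) fun w hw => by rw [hw]; simp).symm

theorem eq_of_coords_eq {d : ℕ} {p q : NCPoly n} (hp : degree p ≤ d) (hq : degree q ≤ d)
    (h : coords d p = coords d q) : p = q := by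
  rw [← ofCoords_coords hp, ← ofCoords_coords hq, h]

theorem coords_real_smul (d : ℕ) (a : ℝ) (p : NCPoly n) :
    coords d ((a : ℂ) • p) = a • coords d p := by
  rw [map_smul]
  ext w
  simp

theorem continuous_coords_mul_mul_star {r : ℕ} (d : ℕ) (g : NCPoly n) :
    Continuous fun c : WordLE n r → ℂ => coords d (ofCoords c * g * star (ofCoords c)) := by
  have h : ∀ c : WordLE n r → ℂ, coords d (ofCoords c * g * star (ofCoords c)) =
      ∑ v, ∑ w, (star (c w) * c v) •
        coords d (MonoidAlgebra.of ℂ _ v.1 * g * star (MonoidAlgebra.of ℂ _ w.1 : NCPoly n)) := by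
    intro c
    simp only [ofCoords, single_eq_smul, star_sum, Finset.sum_mul, Finset.mul_sum, map_sum,
      star_smul, smul_mul_assoc, mul_smul_comm, map_smul, Finset.smul_sum, smul_smul]
    exact Finset.sum_comm
  simp only [h]
  fun_prop

theorem isCompact_unit_coords (r : ℕ) : IsCompact {c : WordLE n r → ℂ | ∑ w, ‖c w‖ ^ 2 = 1} := by
  refine Metric.isCompact_of_isClosed_isBounded
    (isClosed_eq (by fun_prop) continuous_const) ?_
  refine (Metric.isBounded_closedBall (x := 0) (r := 1)).subset fun c hc => ?_
  rw [mem_closedBall_zero_iff]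
  refine (pi_norm_le_iff_of_nonneg zero_le_one).2 fun w => ?_
  have h := Finset.single_le_sum (f := fun w => ‖c w‖ ^ 2) (fun _ _ => by positivity)
    (Finset.mem_univ w)
  rw [hc.out] at h
  exact (sq_le_one_iff₀ (norm_nonneg _)).1 h

end Coordinates

section Multipliers

variable {n m m' : ℕ} (P : Problem n m m')

/-- Polynomials whose real part is of the form `s * g i + g i * s*` modulo the ideal of the
equality constraints. -/
def Problem.IsSlack (i : Fin m) (u : NCPoly n) : Prop :=
  ∃ s, u + star u - (s * P.g i + P.g i * star s) ∈ P.eqIdeal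

/-- Polynomials whose real part is in the ideal of the equality constraints. -/
def Problem.IsNull (u : NCPoly n) : Prop := u + star u ∈ P.eqIdeal

variable {P}

theorem Problem.IsNull.add {u v : NCPoly n} (hu : P.IsNull u) (hv : P.IsNull v) :
    P.IsNull (u + v) := by
  have : u + v + star (u + v) = (u + star u) + (v + star v) := by rw [star_add]; abel
  rw [IsNull, this]
  exact add_mem hu hv

theorem Problem.IsNull.real_smul (a : ℝ) {u : NCPoly n} (hu : P.IsNull u) :
    P.IsNull ((a : ℂ) • u) := by
  have : (a : ℂ) • u + star ((a : ℂ) • u) = (a : ℂ) • (u + star u) := by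
    rw [star_smul, smul_add]; simp
  rw [IsNull, this]
  exact P.eqIdeal.smul_mem _ hu

theorem Problem.IsNull.isSlack {u : NCPoly n} (hu : P.IsNull u) (i : Fin m) : P.IsSlack i u :=
  ⟨0, by rw [zero_mul, star_zero, mul_zero, add_zero, sub_zero]; exact hu⟩

theorem Problem.isNull_sub_star (p : NCPoly n) : P.IsNull (p - star p) := by
  simp [IsNull]

theorem Problem.isNull_zero : P.IsNull 0 := by
  simp [IsNull]

theorem Problem.isNull_of_mem {u : NCPoly n} (hu : u ∈ P.eqIdeal) : P.IsNull u :=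
  add_mem hu (P.star_mem_eqIdeal hu)

theorem Problem.IsSlack.add {i : Fin m} {u v : NCPoly n} (hu : P.IsSlack i u)
    (hv : P.IsSlack i v) : P.IsSlack i (u + v) := by
  obtain ⟨s, hs⟩ := hu
  obtain ⟨t, ht⟩ := hv
  refine ⟨s + t, ?_⟩
  convert add_mem hs ht using 1
  rw [star_add, star_add]
  noncomm_ring

theorem Problem.IsSlack.real_smul (a : ℝ) {i : Fin m} {u : NCPoly n} (hu : P.IsSlack i u) :
    P.IsSlack i ((a : ℂ) • u) := by
  obtain ⟨s, hs⟩ := hu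
  refine ⟨(a : ℂ) • s, ?_⟩
  convert P.eqIdeal.smul_mem (a : ℂ) hs using 1
  simp only [star_smul, smul_sub, smul_add, smul_mul_assoc, mul_smul_comm, RCLike.star_def,
    Complex.conj_ofReal]

theorem Problem.isSlack_mul (i : Fin m) (s : NCPoly n) : P.IsSlack i (s * P.g i) := by
  refine ⟨s, ?_⟩
  rw [star_mul, P.g_hermitian i, sub_self]
  exact zero_mem _

theorem Problem.isSlack_mul' (i : Fin m) (s : NCPoly n) : P.IsSlack i (P.g i * s) := by
  refine ⟨star s, ?_⟩
  rw [star_mul, P.g_hermitian i, star_star, add_comm, sub_self]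
  exact zero_mem _

/-- The hypothesis that there is no first-order descent direction at `σ`. -/
def Problem.NoDescent (P : Problem n m m') (σ : NCPoly n →ₗ[ℂ] ℂ) : Prop :=
  ∀ (t : Fin n → NCPoly n) (q r : Fin m → NCPoly n), star t = t → (∀ i, q i ∈ P.sosCone) →
    (∀ i, grad (P.g i) t - q i - (r i * P.g i + P.g i * star (r i)) ∈ P.eqIdeal) →
    (∀ j, grad (P.h j) t ∈ P.eqIdeal) → 0 ≤ (σ (grad P.f t)).re

variable (P) in
/-- The subspace on which the multipliers are prescribed. -/
def Problem.prescribed (σ : NCPoly n →ₗ[ℂ] ℂ) (d : ℕ) :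
    Submodule ℝ ((Fin m → WordLE n d → ℂ) × (Fin m' → WordLE n d → ℂ) × ℝ) where
  carrier := {v | ∃ (t : Fin n → NCPoly n) (e : Fin m → NCPoly n) (e' : Fin m' → NCPoly n),
    (∀ i, degree (e i) ≤ d) ∧ (∀ j, degree (e' j) ≤ d) ∧
    (∀ i, P.IsSlack i (e i - grad (P.g i) t)) ∧ (∀ j, P.IsNull (e' j - grad (P.h j) t)) ∧
    v = (fun i => coords d (e i), fun j => coords d (e' j), -(σ (grad P.f t)).re)}
  add_mem' := by
    rintro _ _ ⟨t, e, e', h1, h2, h3, h4, rfl⟩ ⟨u, k, k', k1, k2, k3, k4, rfl⟩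
    refine ⟨t + u, e + k, e' + k', fun i => degree_add_le (h1 i) (k1 i),
      fun j => degree_add_le (h2 j) (k2 j), fun i => ?_, fun j => ?_, ?_⟩
    · rw [grad_tuple_add, Pi.add_apply, add_sub_add_comm]
      exact (h3 i).add (k3 i)
    · rw [grad_tuple_add, Pi.add_apply, add_sub_add_comm]
      exact (h4 j).add (k4 j)
    · simp only [Pi.add_apply, map_add, grad_tuple_add, Complex.add_re, neg_add]
      rfl
  zero_mem' := by
    have h0 : ∀ p : NCPoly n, grad p 0 = 0 := fun p => by
      simpa using grad_tuple_smul p 0 0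
    refine ⟨0, 0, 0, fun i => by simp [degree_zero], fun j => by simp [degree_zero],
      fun i => ?_, fun j => ?_, ?_⟩
    · simpa [h0] using isNull_zero.isSlack i
    · simpa [h0] using isNull_zero
    · simp [h0]
      rfl
  smul_mem' := by
    rintro a _ ⟨t, e, e', h1, h2, h3, h4, rfl⟩
    refine ⟨(a : ℂ) • t, (a : ℂ) • e, (a : ℂ) • e', fun i => degree_smul_le _ (h1 i),
      fun j => degree_smul_le _ (h2 j), fun i => ?_, fun j => ?_, ?_⟩
    · rw [grad_tuple_smul, Pi.smul_apply, ← smul_sub]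
      exact (h3 i).real_smul a
    · rw [grad_tuple_smul, Pi.smul_apply, ← smul_sub]
      exact (h4 j).real_smul a
    · simp only [Pi.smul_apply, grad_tuple_smul, map_smul, smul_eq_mul,
        Complex.re_ofReal_mul, ← mul_neg]
      rfl

end Multipliers

section Existence

variable {n m m' : ℕ} {P : Problem n m m'}

/-- Half of the degree of a weight, rounded up. -/
def Problem.weightDegree (P : Problem n m m') (l : Option (Fin m)) : ℕ :=
  (degree (P.weight l) + 1) / 2

theorem Problem.degree_mul_weight_mul_star_le {k : ℕ} {l : Option (Fin m)} {p : NCPoly n}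
    (hp : degree p + P.weightDegree l ≤ k) : degree (p * P.weight l * star p) ≤ 2 * k := by
  have h1 := degree_mul_mul_le p (P.weight l) (star p)
  have h2 := degree_star_le p
  unfold weightDegree at hp
  omega

/-- The normalized weighted squares of degree at most `2 * k`. -/
def Problem.unitSquares (P : Problem n m m') (ε : Fin m → ℝ) (k : ℕ) :
    Set (Fin m → WordLE n (2 * k) → ℂ) :=
  ⋃ (i : Fin m) (l : Option (Fin m)) (_ : P.weightDegree l ≤ k),
    (fun c : WordLE n (k - P.weightDegree l) → ℂ => Pi.single i
      ((ε i)⁻¹ • coords (2 * k) (ofCoords c * P.weight l * star (ofCoords c)))) ''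
      {c | ∑ w, ‖c w‖ ^ 2 = 1}

theorem Problem.isCompact_unitSquares (ε : Fin m → ℝ) (k : ℕ) :
    IsCompact (P.unitSquares ε k) := by
  refine isCompact_iUnion fun i => isCompact_iUnion fun l => isCompact_iUnion fun _ =>
    (isCompact_unit_coords _).image ?_
  have h := (continuous_coords_mul_mul_star (r := k - P.weightDegree l) (2 * k)
    (P.weight l)).const_smul (ε i)⁻¹
  exact (continuous_single i).comp h

theorem Problem.single_mem_unitSquares (ε : Fin m → ℝ) {k : ℕ} (i : Fin m) {l : Option (Fin m)}
    {p : NCPoly n} (hp : degree p + P.weightDegree l ≤ k) (h1 : coeffNormSq p = 1) :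
    Pi.single i ((ε i)⁻¹ • coords (2 * k) (p * P.weight l * star p)) ∈ P.unitSquares ε k := by
  have hp' : degree p ≤ k - P.weightDegree l := by omega
  refine Set.mem_iUnion.2 ⟨i, Set.mem_iUnion.2 ⟨l, Set.mem_iUnion.2 ⟨by omega,
    coords _ p, ?_, ?_⟩⟩⟩
  · exact (sum_norm_sq_coords hp').trans h1
  · simp only [ofCoords_coords hp']

/-- Convex combinations of normalized weighted squares are weighted sums of squares. -/
theorem Problem.exists_mem_sosCone_of_mem_convexHull {ε : Fin m → ℝ} (hε : ∀ i, 0 < ε i) {k : ℕ}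
    {b : Fin m → WordLE n (2 * k) → ℂ} (hb : b ∈ convexHull ℝ (insert 0 (P.unitSquares ε k)))
    (i : Fin m) : ∃ q ∈ P.sosCone, degree q ≤ 2 * k ∧ b i = coords (2 * k) q := by
  have hsub : convexHull ℝ (insert 0 (P.unitSquares ε k)) ⊆
      {b | ∀ i, ∃ q ∈ P.sosCone, degree q ≤ 2 * k ∧ b i = coords (2 * k) q} := by
    refine convexHull_min ?_ ?_
    · rintro b (rfl | hb) i'
      · exact ⟨0, zero_mem _, by simp [degree_zero], by simp⟩
      · simp only [unitSquares, Set.mem_iUnion] at hb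
        obtain ⟨i, l, hl, c, -, rfl⟩ := hb
        have hc := degree_ofCoords_le c
        by_cases hii : i' = i
        · subst hii
          refine ⟨(((ε i')⁻¹ : ℝ) : ℂ) • (ofCoords c * P.weight l * star (ofCoords c)),
            P.smul_mem_sosCone (inv_nonneg.2 (hε i').le) (P.mul_weight_mul_mem_sosCone l _),
            degree_smul_le _ (P.degree_mul_weight_mul_star_le (by omega)), ?_⟩
          simp only [Pi.single_eq_same, coords_real_smul]
        · exact ⟨0, zero_mem _, by simp [degree_zero], by simp [hii]⟩
    · intro b hb b' hb' x y hx hy _ i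
      obtain ⟨q, hq, hqd, hqb⟩ := hb i
      obtain ⟨q', hq', hqd', hqb'⟩ := hb' i
      refine ⟨(x : ℂ) • q + (y : ℂ) • q',
        add_mem (P.smul_mem_sosCone hx hq) (P.smul_mem_sosCone hy hq'),
        degree_add_le (degree_smul_le _ hqd) (degree_smul_le _ hqd'), ?_⟩
      rw [map_add, coords_real_smul, coords_real_smul, ← hqb, ← hqb']
      rfl
  exact hsub hb i

theorem Problem.NoDescent.disjoint {σ : NCPoly n →ₗ[ℂ] ℂ} (hσ : P.NoDescent σ)
    (hstar : ∀ p, σ (star p) = star (σ p)) (hf : IsSelfAdjoint P.f) {ε : Fin m → ℝ}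
    (hε : ∀ i, 0 < ε i) (k : ℕ) :
    Disjoint (convexHull ℝ (insert 0 (P.unitSquares ε k)) ×ˢ {((0, 1) :
      (Fin m' → WordLE n (2 * k) → ℂ) × ℝ)}) (P.prescribed σ (2 * k) : Set _) := by
  rw [Set.disjoint_left]
  rintro ⟨b, x⟩ ⟨hb, hx⟩ ⟨t, e, e', he, he', hs, hn, heq⟩
  rw [Set.mem_singleton_iff] at hx
  subst hx
  obtain ⟨rfl, h2⟩ := Prod.mk.inj heq
  obtain ⟨h2, h3⟩ := Prod.mk.inj h2
  choose q hq hqd hqe using fun i => P.exists_mem_sosCone_of_mem_convexHull hε hb i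
  have hqe : ∀ i, e i = q i := fun i => eq_of_coords_eq (he i) (hqd i) (hqe i)
  have he0 : ∀ j, e' j = 0 := fun j =>
    eq_of_coords_eq (he' j) (by simp [degree_zero]) (by rw [map_zero]; exact (congrFun h2 j).symm)
  choose s hs using hs
  have hgrad : ∀ {p : NCPoly n}, star p = p → grad p (t + star t) = grad p t + star (grad p t) := by
    intro p hp
    rw [grad_tuple_add, ← grad_star p t, hp]
  have hpos := hσ (t + star t) (fun i => q i + q i) (fun i => -s i) ?_ ?_ ?_ ?_
  · rw [hgrad hf, map_add, hstar, Complex.add_re] at hpos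
    simp only [RCLike.star_def, Complex.conj_re] at hpos
    linarith
  · rw [star_add, star_star, add_comm]
  · exact fun i => add_mem (hq i) (hq i)
  · intro i
    rw [hgrad (P.g_hermitian i)]
    convert P.eqIdeal.neg_mem (hs i) using 1
    rw [hqe i, star_sub, P.star_eq_of_mem_sosCone (hq i), star_neg]
    noncomm_ring
  · intro j
    rw [hgrad (P.h_hermitian j)]
    have := hn j
    rw [he0 j, IsNull, zero_sub, star_neg] at this
    convert P.eqIdeal.neg_mem this using 1
    abel

/-- Duality: in the absence of descent directions there are approximate multipliers. -/
theorem Problem.NoDescent.exists_multipliers {σ : NCPoly n →ₗ[ℂ] ℂ} (hσ : P.NoDescent σ)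
    (hstar : ∀ p, σ (star p) = star (σ p)) (hf : IsSelfAdjoint P.f) {ε : Fin m → ℝ}
    (hε : ∀ i, 0 < ε i) (k : ℕ) :
    ∃ (M : Fin m → NCPoly n →ₗ[ℂ] ℂ) (N : Fin m' → NCPoly n →ₗ[ℂ] ℂ),
      (∀ (t : Fin n → NCPoly n) (e : Fin m → NCPoly n) (e' : Fin m' → NCPoly n),
        (∀ i, degree (e i) ≤ 2 * k) → (∀ j, degree (e' j) ≤ 2 * k) →
        (∀ i, P.IsSlack i (e i - grad (P.g i) t)) → (∀ j, P.IsNull (e' j - grad (P.h j) t)) →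
        ∑ i, (M i (e i)).re + ∑ j, (N j (e' j)).re = (σ (grad P.f t)).re) ∧
      ∀ i l p, degree p + P.weightDegree l ≤ k → coeffNormSq p = 1 →
        0 ≤ (M i (p * P.weight l * star p)).re + ε i := by
  obtain ⟨F, hF0, hFpos⟩ := exists_linear_pos_of_disjoint
    ((isCompact_convexHull ((P.isCompact_unitSquares ε k).insert 0)).prod isCompact_singleton)
    ((convex_convexHull ℝ _).prod (convex_singleton _)) _ (hσ.disjoint hstar hf hε k)
  set c := F (0, 0, 1) with hc
  have hcpos : 0 < c := hFpos (0, 0, 1)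
    ⟨subset_convexHull ℝ _ (Set.mem_insert _ _), rfl⟩
  let V := (Fin m → WordLE n (2 * k) → ℂ) × (Fin m' → WordLE n (2 * k) → ℂ) × ℝ
  let F1 : (Fin m → WordLE n (2 * k) → ℂ) →ₗ[ℝ] ℝ := c⁻¹ • F ∘ₗ LinearMap.inl ℝ _ _
  let F2 : (Fin m' → WordLE n (2 * k) → ℂ) →ₗ[ℝ] ℝ :=
    c⁻¹ • F ∘ₗ LinearMap.inr ℝ _ _ ∘ₗ LinearMap.inl ℝ _ _
  have hsplit : ∀ x y (r : ℝ), F (x, y, r) = c * (F1 x + F2 y + r) := by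
    intro x y r
    have e : (x, y, r) = LinearMap.inl ℝ _ ((Fin m' → WordLE n (2 * k) → ℂ) × ℝ) x +
        LinearMap.inr ℝ (Fin m → WordLE n (2 * k) → ℂ) _ (LinearMap.inl ℝ _ ℝ y) +
        r • ((0, 0, 1) : V) := by
      simp
    rw [e, map_add, map_add, map_smul]
    simp only [F1, F2, LinearMap.smul_apply, LinearMap.comp_apply, smul_eq_mul, ← hc]
    field_simp
  refine ⟨fun i => Module.Dual.extendRCLike (F1 ∘ₗ LinearMap.single ℝ _ i) ∘ₗ coords (2 * k),
    fun j => Module.Dual.extendRCLike (F2 ∘ₗ LinearMap.single ℝ _ j) ∘ₗ coords (2 * k), ?_, ?_⟩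
  · intro t e e' he he' hs hn
    have h := hF0 _ (show ((fun i => coords (2 * k) (e i), fun j => coords (2 * k) (e' j),
      -(σ (grad P.f t)).re) : V) ∈ P.prescribed σ (2 * k) from
        ⟨t, e, e', he, he', hs, hn, rfl⟩)
    rw [hsplit] at h
    have h := (mul_eq_zero.1 h).resolve_left hcpos.ne'
    have s1 : ∀ i, ((Module.Dual.extendRCLike (F1 ∘ₗ LinearMap.single ℝ _ i) ∘ₗ coords (2 * k)) (e i) : ℂ).re =
        F1 (Pi.single i (coords (2 * k) (e i))) := fun i =>
      Module.Dual.re_extendRCLike_apply (𝕜 := ℂ) _ _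
    have s2 : ∀ j, ((Module.Dual.extendRCLike (F2 ∘ₗ LinearMap.single ℝ _ j) ∘ₗ coords (2 * k)) (e' j) : ℂ).re =
        F2 (Pi.single j (coords (2 * k) (e' j))) := fun j =>
      Module.Dual.re_extendRCLike_apply (𝕜 := ℂ) _ _
    simp only [s1, s2]
    rw [← map_sum, ← map_sum, Finset.univ_sum_single (fun i => coords (2 * k) (e i)),
      Finset.univ_sum_single (fun j => coords (2 * k) (e' j))]
    linarith
  · intro i l p hp hp1
    have h := hFpos (Pi.single i ((ε i)⁻¹ • coords (2 * k) (p * P.weight l * star p)), 0, 1)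
      ⟨subset_convexHull ℝ _ (Set.mem_insert_of_mem _ (P.single_mem_unitSquares ε i hp hp1)), rfl⟩
    rw [hsplit, map_zero, add_zero, Pi.single_smul, map_smul, smul_eq_mul] at h
    have h := pos_of_mul_pos_right h hcpos.le
    have s1 : ((Module.Dual.extendRCLike (F1 ∘ₗ LinearMap.single ℝ _ i) ∘ₗ coords (2 * k))
        (p * P.weight l * star p) : ℂ).re =
        F1 (Pi.single i (coords (2 * k) (p * P.weight l * star p))) :=
      Module.Dual.re_extendRCLike_apply (𝕜 := ℂ) _ _
    rw [s1]
    have hi := hε i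
    have h' := mul_pos hi h
    rw [mul_add, mul_inv_cancel_left₀ hi.ne', mul_one] at h'
    exact h'.le

end Existence

section Conditions

variable {n m m' : ℕ} {P : Problem n m m'}

/-- Scaling of a quadratic lower bound from unit vectors. -/
theorem nonneg_add_of_unit {M : NCPoly n →ₗ[ℂ] ℂ} {ε : ℝ} {g : NCPoly n} {r : ℕ}
    (h : ∀ p, degree p ≤ r → coeffNormSq p = 1 → 0 ≤ (M (p * g * star p)).re + ε)
    {p : NCPoly n} (hp : degree p ≤ r) :
    0 ≤ (M (p * g * star p)).re + ε * coeffNormSq p := by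
  have hsq : ∀ (a : ℝ) (q : NCPoly n), degree q ≤ r →
      coeffNormSq ((a : ℂ) • q) = a ^ 2 * coeffNormSq q := by
    intro a q hq
    rw [← sum_norm_sq_coords (degree_smul_le _ hq), ← sum_norm_sq_coords hq, Finset.mul_sum]
    refine Finset.sum_congr rfl fun w _ => ?_
    rw [coords_real_smul, Pi.smul_apply, norm_smul, mul_pow, Real.norm_eq_abs, sq_abs]
  have hN0 : 0 ≤ coeffNormSq p := Finset.sum_nonneg fun _ _ => by positivity
  rcases hN0.eq_or_lt with h0 | h0
  · have hp0 : p = 0 := by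
      rw [← sum_norm_sq_coords hp] at h0
      have := (Finset.sum_eq_zero_iff_of_nonneg fun _ _ => by positivity).1 h0.symm
      refine eq_of_coords_eq hp (by simp [degree_zero]) ?_
      ext w
      simpa using this w (Finset.mem_univ _)
    subst hp0
    rw [← h0]
    simp
  · set a : ℝ := (√(coeffNormSq p))⁻¹ with ha
    have ha2 : a ^ 2 = (coeffNormSq p)⁻¹ := by rw [ha, inv_pow, Real.sq_sqrt hN0]
    have h1 := h ((a : ℂ) • p) (degree_smul_le _ hp)
      (by rw [hsq a p hp, ha2, inv_mul_cancel₀ h0.ne'])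
    have e : ((a : ℂ) • p) * g * star ((a : ℂ) • p) = ((a ^ 2 : ℝ) : ℂ) • (p * g * star p) := by
      rw [star_smul, smul_mul_assoc, smul_mul_assoc, mul_smul_comm, smul_smul]
      congr 1
      simp [pow_two]
    rw [e, map_smul, smul_eq_mul, Complex.re_ofReal_mul, ha2] at h1
    have h2 := mul_nonneg h0.le h1
    rw [mul_add, mul_inv_cancel_left₀ h0.ne'] at h2
    linarith

theorem eq_zero_of_re_eq_zero {M : NCPoly n →ₗ[ℂ] ℂ} {u : NCPoly n} (h1 : (M u).re = 0)
    (h2 : (M (Complex.I • u)).re = 0) : M u = 0 := by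
  rw [map_smul] at h2
  apply Complex.ext
  · exact h1
  · simpa using h2

theorem map_star_of_re_sub_star {M : NCPoly n →ₗ[ℂ] ℂ} {d : ℕ}
    (h : ∀ p, degree p ≤ d → (M (p - star p)).re = 0) {p : NCPoly n} (hp : degree p ≤ d) :
    M (star p) = star (M p) := by
  have h1 := h p hp
  have h2 := h (Complex.I • p) (degree_smul_le _ hp)
  rw [star_smul, map_sub, map_smul, map_smul] at h2
  rw [map_sub] at h1
  simp at h1 h2
  apply Complex.ext
  · simp; linarith
  · simp; linarith

theorem tupleDegree_smul_le (c : ℂ) (t : Fin n → NCPoly n) : tupleDegree (c • t) ≤ tupleDegree t :=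
  Finset.sup_le fun i _ => degree_smul_le c
    (Finset.le_sup (f := fun i => degree (t i)) (Finset.mem_univ i))

theorem Problem.NoDescent.essentialKKTAt {σ : NCPoly n →ₗ[ℂ] ℂ} (hσ : P.NoDescent σ)
    (hstar : ∀ p, σ (star p) = star (σ p)) (hf : IsSelfAdjoint P.f) : P.EssentialKKTAt σ := by
  intro k ε hε
  obtain ⟨M, N, hMN, hpos⟩ := hσ.exists_multipliers hstar hf hε k
  have hgrad0 : ∀ p : NCPoly n, grad p 0 = 0 := fun p => by
    simpa using grad_tuple_smul p 0 0
  have hM : ∀ i u, degree u ≤ 2 * k → P.IsSlack i u → (M i u).re = 0 := by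
    intro i u hu hs
    have h := hMN 0 (Pi.single i u) 0 (fun i' => ?_) (fun j => by simp [degree_zero])
      (fun i' => ?_) (fun j => by simpa [hgrad0] using isNull_zero)
    · rw [hgrad0, map_zero, Finset.sum_eq_single i] at h
      · simpa using h
      · intro i' _ hi'
        simp [hi']
      · simp
    · by_cases hi : i' = i
      · subst hi; simpa using hu
      · simp [hi, degree_zero]
    · rw [hgrad0, sub_zero]
      by_cases hi : i' = i
      · subst hi; simpa using hs
      · simpa [hi] using isNull_zero.isSlack i'
  have hN : ∀ j u, degree u ≤ 2 * k → P.IsNull u → (N j u).re = 0 := by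
    intro j u hu hs
    have h := hMN 0 0 (Pi.single j u) (fun i => by simp [degree_zero]) (fun j' => ?_)
      (fun i => by simpa [hgrad0] using isNull_zero.isSlack i) (fun j' => ?_)
    · rw [hgrad0, map_zero, Finset.sum_eq_single (s := Finset.univ (α := Fin m')) j] at h
      · simpa using h
      · intro j' _ hj'
        simp [hj']
      · simp
    · by_cases hj : j' = j
      · subst hj; simpa using hu
      · simp [hj, degree_zero]
    · rw [hgrad0, sub_zero]
      by_cases hj : j' = j
      · subst hj; simpa using hs
      · simpa [hj] using isNull_zero
  have hsub : ∀ {p : NCPoly n}, degree p ≤ 2 * k → degree (p - star p) ≤ 2 * k := by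
    intro p hp
    rw [sub_eq_add_neg, ← neg_one_smul ℂ (star p)]
    exact degree_add_le hp (degree_smul_le _ ((degree_star_le p).trans hp))
  have hMstar : ∀ i {p}, degree p ≤ 2 * k → M i (star p) = star (M i p) := fun i p hp =>
    map_star_of_re_sub_star (fun q hq => hM i _ (hsub hq) ((isNull_sub_star q).isSlack i)) hp
  have hNstar : ∀ j {p}, degree p ≤ 2 * k → N j (star p) = star (N j p) := fun j p hp =>
    map_star_of_re_sub_star (fun q hq => hN j _ (hsub hq) (isNull_sub_star q)) hp
  have hM0 : ∀ i {u}, degree u ≤ 2 * k → P.IsSlack i u → P.IsSlack i (Complex.I • u) →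
      M i u = 0 := fun i u hu h1 h2 =>
    eq_zero_of_re_eq_zero (hM i u hu h1) (hM i _ (degree_smul_le _ hu) h2)
  have hN0 : ∀ j {u}, degree u ≤ 2 * k → u ∈ P.eqIdeal → N j u = 0 := fun j u hu h =>
    eq_zero_of_re_eq_zero (hN j u hu (isNull_of_mem h))
      (hN j _ (degree_smul_le _ hu) (isNull_of_mem (P.eqIdeal.smul_mem _ h)))
  have hweight : ∀ i l p, degree p + P.weightDegree l ≤ k →
      0 ≤ M i (p * P.weight l * star p) + ((ε i * coeffNormSq p : ℝ) : ℂ) := by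
    intro i l p hp
    have hdeg := P.degree_mul_weight_mul_star_le hp
    have hre := nonneg_add_of_unit (M := M i) (ε := ε i) (g := P.weight l)
      (r := k - P.weightDegree l) (fun q hq => hpos i l q (by omega)) (p := p) (by omega)
    have him := hMstar i hdeg
    rw [star_mul, star_mul, star_star, P.weight_hermitian, ← mul_assoc] at him
    rw [Complex.nonneg_iff, Complex.add_re, Complex.add_im, Complex.ofReal_re, Complex.ofReal_im,
      add_zero]
    exact ⟨hre, (Complex.conj_eq_iff_im.1 him.symm).symm⟩
  refine ⟨fun i => (M i).domRestrict _, fun j => (N j).domRestrict _, fun i p hp => hMstar i hp,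
    fun j p hp => hNstar j hp, fun i p hp => ?_, fun i l p hp => hweight i (some l) p hp,
    fun i j s s' hs => ?_, fun i s hs => ⟨?_, ?_⟩, fun j l s s' hs => ?_, fun t hft hgt hht => ?_⟩
  · have h := hweight i none p (by
      have h1 : degree (1 : NCPoly n) ≤ 0 := degree_single_le 1 1
      change degree p + (degree (1 : NCPoly n) + 1) / 2 ≤ k
      omega)
    have e : p * P.weight none * star p = p * star p := by simp [weight]
    rw [e] at h
    exact h
  · have hmem := P.mul_h_mul_mem_eqIdeal j s s'
    exact hM0 i ((degree_mul_mul_le s _ s').trans hs) ((isNull_of_mem hmem).isSlack i)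
      ((isNull_of_mem (P.eqIdeal.smul_mem _ hmem)).isSlack i)
  · refine hM0 i ((degree_mul_le s _).trans hs) (isSlack_mul i s) ?_
    change P.IsSlack i (Complex.I • (s * P.g i))
    rw [← smul_mul_assoc]
    exact isSlack_mul i _
  · refine hM0 i ((degree_mul_le _ s).trans ((Nat.add_comm _ _).trans_le hs)) (isSlack_mul' i s) ?_
    change P.IsSlack i (Complex.I • (P.g i * s))
    rw [← mul_smul_comm]
    exact isSlack_mul' i _
  · exact hN0 j ((degree_mul_mul_le s _ s').trans hs) (P.mul_h_mul_mem_eqIdeal l s s')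
  · have hre : ∀ u : Fin n → NCPoly n, tupleDegree u ≤ tupleDegree t →
        (σ (grad P.f u) - ∑ i, M i (grad (P.g i) u) - ∑ j, N j (grad (P.h j) u)).re = 0 := by
      intro u hu
      have h := hMN u (fun i => grad (P.g i) u) (fun j => grad (P.h j) u)
        (fun i => (degree_grad_le _ _).trans ((Nat.add_le_add_left hu _).trans (hgt i)))
        (fun j => (degree_grad_le _ _).trans ((Nat.add_le_add_left hu _).trans (hht j)))
        (fun i => by rw [sub_self]; exact isNull_zero.isSlack i)
        (fun j => by rw [sub_self]; exact isNull_zero)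
      rw [Complex.sub_re, Complex.sub_re, Complex.re_sum, Complex.re_sum]
      linarith
    have h1 := hre t le_rfl
    have h2 := hre (Complex.I • t) (tupleDegree_smul_le _ _)
    simp only [grad_tuple_smul, map_smul, ← Finset.smul_sum, ← smul_sub] at h2
    rw [smul_eq_mul, Complex.I_mul_re, neg_eq_zero] at h2
    exact Complex.ext h1 h2

end Conditions

end NPO

end

theorem mainTheorem1 {n m m' : ℕ} (P : NPO.Problem n m m') :
    (∀ σ : NPO.NCPoly n →ₗ[ℂ] ℂ, P.IsMinimizer σ → NPO.IsBounded σ → P.EssentialKKTAt σ) ∧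
    (P.IsArchimedean → P.EssentialNcKKT) := by
  have h : ∀ σ : NPO.NCPoly n →ₗ[ℂ] ℂ, P.IsMinimizer σ → NPO.IsBounded σ → P.EssentialKKTAt σ :=
    fun σ hσ hb => NPO.Problem.NoDescent.essentialKKTAt
      (fun _ _ _ ht hq hg hh => hσ.re_grad_nonneg hb ht hq hg hh)
      (NPO.map_star_of_nonneg hσ.1.nonneg) P.f_hermitian
  exact ⟨h, fun hA σ hσ => h σ hσ (hA.isBounded hσ.1)⟩
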